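/- **Theorem 5.2 (Centro-affine Bochner formula).** Let $n\ge 1$ and let $K\subset E=\mathbb{R}^n$ be a convex body with the origin in its interior, whose boundary $\partial K$ is $C^\infty$-smooth with strictly positive curvature (i.e. positive definite second fundamental form); this class is denoted $\mathcal{K}^\infty_+$. Let $M$ be a closed smooth $(n-1)$-dimensional manifold and let $x=x_K:M\to E$ be a smooth parametrization of $\partial K$, i.e. an injective smooth immersion with $x(M)=\partial K$ (for example $M=\partial K$ with $x$ the inclusion, or the Euclidean unit sphere of $E$ with $x(\theta)=\theta/\|\theta\|_K$, or the Euclidean unit sphere of $E^*$ with $x=\nabla h_K$, or $M=\partial K^*\subset E^*$ with $x=\nabla h_K$, where $\|\cdot\|_K$ is the gauge and $h_K$ the support function of $K$, and $K^*=\{h_K\le 1\}$ is the dual body). Equip $M$ with the centro-affine normalization, in which $x$ itself is the transversal normal field. Thus: * the metric $g_K$ and the torsion-free connection $\nabla_K$ are defined by the Gauss equation $\bar D_U\,dx(V)=dx((\nabla_K)_UV)-g_K(U,V)\,x$, where $\bar D$ is the flat connection; * the conormal $x^*:M\to E^*$ is defined by $\langle x^*,x\rangle=1$, $\langle x^*,dx\rangle=0$,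 and the conjugate connection $\nabla_K^*$ is defined by the Gauss equation $\bar D_U\,dx^*(V)=dx^*((\nabla_K^*)_UV)-g_K(U,V)\,x^*$; * $\nu_K$ is the measure on $M$ given by the absolute value of the volume form $(e_1,\dots,e_{n-1})\mapsto \mathrm{Det}(dx(e_1),\dots,dx(e_{n-1}),x)$. For $f\in C^2(M)$ let $\mathrm{grad}_{g_K}f$ be the $g_K$-gradient of $f$, let $\Delta_Kf=\mathrm{div}^{\nabla_K}\,\mathrm{grad}_{g_K}f$ with $\mathrm{div}^{\nabla}X=\mathrm{tr}(Y\mapsto\nabla_YX)$, let $\mathrm{Hess}^*_Kf(X,Y)=X(Y(f))-((\nabla^*_K)_XY)(f)$, and, for a symmetric $(0,2)$-tensor $A$, let $\|A\|_{g_K}^2=g_K^{ij}A_{jk}g_K^{kl}A_{li}$; finally $|X|^2=g_K(X,X)$ for a vector field $X$. Then for every $f\in C^2(M)$ the functions $(\Delta_Kf)^2$, $\|\mathrm{Hess}^*_Kf\|^2_{g_K}$ and $|\mathrm{grad}_{g_K}f|^2$ are $\nu_K$-integrable, and $$\int_M(\Delta_Kf)^2\,d\nu_K-\int_M\|\mathrm{Hess}^*_Kf\|_{g_K}^2\,d\nu_K=(n-2)\int_M|\mathrm{grad}_{g_K}f|^2\,d\nu_K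 .$$ -/

import Mathlib

open scoped Manifold ContDiff

noncomputable section

namespace CentroAffine

/-! ### Convex bodies -/

/-- `K` has the origin in its interior, its boundary is `C^∞`-smooth and the curvature of the boundary
is strictly positive: near each boundary point `y`, the body is a sublevel set `{ρ ≤ 0}` of a smooth
function with non-zero differential at `y`, and the second fundamental form of `∂K` at `y` with
respect to the outer unit normal, namely `D²ρ(y) / |Dρ(y)|` restricted to the tangent space
`ker Dρ(y)`, is positive definite. -/
structure SmoothPosCurved {E : Type*} [NormedAddCommGroup E] [NormedSpace ℝ E]
    (K : ConvexBody E) : Prop where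
  zero_mem : (0 : E) ∈ interior (K : Set E)
  boundary : ∀ y ∈ frontier (K : Set E), ∃ (U : Set E) (ρ : E → ℝ),
    IsOpen U ∧ y ∈ U ∧ ContDiffOn ℝ ∞ ρ U ∧ (∀ z ∈ U, z ∈ K ↔ ρ z ≤ 0) ∧
    fderiv ℝ ρ y ≠ 0 ∧
    ∀ v : E, v ≠ 0 → fderiv ℝ ρ y v = 0 → 0 < fderiv ℝ (fderiv ℝ ρ) y v v

/-! ### Centro-affine structures in coordinates

Here `X : V → W` is a hypersurface `x` read in a chart of `M` with values in `V = ℝⁿ⁻¹`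
(or its conormal read in that chart), normalized by the transversal field `ξ = x`. -/

section Coordinates

variable {V W : Type*} [NormedAddCommGroup V] [NormedSpace ℝ V]
  [NormedAddCommGroup W] [NormedSpace ℝ W]

/-- The map `(v, t) ↦ dX(v) + t X`; it is invertible exactly when `X` is an immersed hypersurface to
which the position vector is transversal. -/
def frame (X : V → W) (u : V) : V × ℝ →L[ℝ] W :=
  (fderiv ℝ X u).coprod (ContinuousLinearMap.toSpanSingleton ℝ (X u))

/-- The Christoffel symbol `Γ(v, w)` of the induced connection: the tangential part in the Gauss
equation `D²X(v, w) = dX(Γ(v, w)) - g(v, w) X`. -/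
def christoffel (X : V → W) (u : V) : V →L[ℝ] V →L[ℝ] V :=
  (ContinuousLinearMap.compL ℝ V W V
    ((ContinuousLinearMap.fst ℝ V ℝ).comp (frame X u).inverse)).comp (fderiv ℝ (fderiv ℝ X) u)

/-- The centro-affine metric `g(v, w)`: minus the transversal part in the Gauss equation
`D²X(v, w) = dX(Γ(v, w)) - g(v, w) X`. -/
def metric (X : V → W) (u : V) : V →L[ℝ] V →L[ℝ] ℝ :=
  -(ContinuousLinearMap.compL ℝ V W ℝ
    ((ContinuousLinearMap.snd ℝ V ℝ).comp (frame X u).inverse)).comp (fderiv ℝ (fderiv ℝ X) u)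

/-- The conormal field `x* : M → E*`: the functional with `⟨x*, x⟩ = 1` and `⟨x*, dx⟩ = 0`, i.e. the
coefficient of `x` in the decomposition along `dx(TM) ⊕ ℝ x`. -/
def conormal (X : V → W) (u : V) : W →L[ℝ] ℝ :=
  (ContinuousLinearMap.snd ℝ V ℝ).comp (frame X u).inverse

/-- The conjugate connection `∇*`: the connection induced by the conormal field through its
Gauss equation. -/
def christoffelStar (X : V → W) (u : V) : V →L[ℝ] V →L[ℝ] V :=
  christoffel (conormal X) u

/-- The metric gradient: `g(grad F, ·) = dF`. -/
def grad (X : V → W) (F : V → ℝ) (u : V) : V :=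
  (metric X u).inverse (fderiv ℝ F u)

/-- The squared length `|grad F|²` with respect to the centro-affine metric. -/
def gradNormSq (X : V → W) (F : V → ℝ) (u : V) : ℝ :=
  metric X u (grad X F u) (grad X F u)

/-- The divergence `tr (v ↦ ∇_v Y)` of a vector field `Y`, where `∇_v Y = dY(v) + Γ(v, Y)`. -/
def divergence (X : V → W) (Y : V → V) (u : V) : ℝ :=
  LinearMap.trace ℝ V (fderiv ℝ Y u + (christoffel X u).flip (Y u) : V →L[ℝ] V).toLinearMap

/-- The centro-affine Laplacian `Δ F = div^∇ (grad_g F)`. -/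
def laplacian (X : V → W) (F : V → ℝ) (u : V) : ℝ :=
  divergence X (grad X F) u

/-- The Hessian with respect to the conjugate connection,
`Hess* F (v, w) = D²F(v, w) - dF(Γ*(v, w))`. -/
def hessStar (X : V → W) (F : V → ℝ) (u : V) : V →L[ℝ] V →L[ℝ] ℝ :=
  fderiv ℝ (fderiv ℝ F) u -
    (ContinuousLinearMap.compL ℝ V V ℝ (fderiv ℝ F u)).comp (christoffelStar X u)

/-- The squared Hilbert-Schmidt norm `g^{ij} A_{jk} g^{kl} A_{li}` of a symmetric tensor `A`. -/
def tensorNormSq (g A : V →L[ℝ] V →L[ℝ] ℝ) : ℝ :=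
  LinearMap.trace ℝ V ((g.inverse.comp A).comp (g.inverse.comp A)).toLinearMap

end Coordinates

/-- The absolute value of the coefficient `Det(∂₁X, …, ∂ₘX, X)` of the centro-affine volume form. -/
def volDensity {m : ℕ} (X : EuclideanSpace ℝ (Fin m) → EuclideanSpace ℝ (Fin (m + 1)))
    (u : EuclideanSpace ℝ (Fin m)) : ℝ :=
  |(EuclideanSpace.basisFun (Fin (m + 1)) ℝ).toBasis.det
    (Fin.snoc (α := fun _ => EuclideanSpace ℝ (Fin (m + 1)))
      (fun i : Fin m => fderiv ℝ X u (EuclideanSpace.basisFun (Fin m) ℝ i)) (X u))|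

/-! ### Centro-affine structures on a parametrizing manifold

The scalars below are invariants, computed at `p` in the chart at `p`. -/

section Manifold

variable {m : ℕ} {M : Type*} [TopologicalSpace M] [ChartedSpace (EuclideanSpace ℝ (Fin m)) M]

/-- A map on `M` read in the chart at `p`. -/
def inChart {β : Type*} (F : M → β) (p : M) : EuclideanSpace ℝ (Fin m) → β :=
  F ∘ (extChartAt (𝓡 m) p).symm

/-- `Δ_K f` on `M`. -/
def lap (x : M → EuclideanSpace ℝ (Fin (m + 1))) (f : M → ℝ) (p : M) : ℝ :=
  laplacian (inChart x p) (inChart f p) (extChartAt (𝓡 m) p p)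

/-- `‖Hess*_K f‖²` with respect to `g_K`, on `M`. -/
def hessStarNormSq (x : M → EuclideanSpace ℝ (Fin (m + 1))) (f : M → ℝ) (p : M) : ℝ :=
  tensorNormSq (metric (inChart x p) (extChartAt (𝓡 m) p p))
    (hessStar (inChart x p) (inChart f p) (extChartAt (𝓡 m) p p))

/-- `|grad f|²` with respect to `g_K`, on `M`. -/
def gradSq (x : M → EuclideanSpace ℝ (Fin (m + 1))) (f : M → ℝ) (p : M) : ℝ :=
  gradNormSq (inChart x p) (inChart f p) (extChartAt (𝓡 m) p p)

/-- The measure `|ν|` on `M` of the centro-affine volume form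
`ν(e₁, …, eₘ) = Det(dx(e₁), …, dx(eₘ), x)`. In each chart it has the density `volDensity` with respect
to Lebesgue measure; as the measures so defined on the chart domains agree on overlaps, the measure
on `M` which they form is their supremum. -/
def volMeasure [MeasurableSpace M] (x : M → EuclideanSpace ℝ (Fin (m + 1))) :
    MeasureTheory.Measure M :=
  ⨆ p : M, MeasureTheory.Measure.map (extChartAt (𝓡 m) p).symm
    ((MeasureTheory.volume.restrict (extChartAt (𝓡 m) p).target).withDensity
      (fun u => ENNReal.ofReal (volDensity (inChart x p) u)))

/-- `x : M → E` is a smooth parametrization (an injective immersion of `M`) of the boundary of `K`. -/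
structure Parametrizes (x : M → EuclideanSpace ℝ (Fin (m + 1)))
    (K : ConvexBody (EuclideanSpace ℝ (Fin (m + 1)))) : Prop where
  smooth : ContMDiff (𝓡 m) 𝓘(ℝ, EuclideanSpace ℝ (Fin (m + 1))) ∞ x
  immersion : ∀ p : M, Function.Injective
    (mfderiv (𝓡 m) 𝓘(ℝ, EuclideanSpace ℝ (Fin (m + 1))) x p)
  injective : Function.Injective x
  range_eq : Set.range x = frontier (K : Set (EuclideanSpace ℝ (Fin (m + 1))))

end Manifold

end CentroAffine

end

/-!
Radial extension turns the formula into flat calculus on `E = ℝ^{m+1}`. Let `N` be the gauge of `K`,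
let `F` be the `0`-homogeneous function on `E ∖ {0}` with `F (t • x p) = f p`, and let `ζ` be the
gradient of `F` with respect to the Hessian metric `D²(N²/2)`. The field `ζ` is of class `C¹`,
homogeneous of degree `-1` and tangent to the level sets of `N`, and along the hypersurface
`ζ ∘ x = dx (grad f)`.

The conormal is `DN ∘ x` and `g(v, w) = D²N (dx v, dx w)`. With `B` the tangential part of `Dζ`,
differentiating `ζ ∘ x = dx (grad f)` gives `∇ (grad f) = B`, and differentiating
`⟨dx*(w), ζ⟩ = df(w)` gives `Hess* f (v, w) = g (B v, w)`. Taking traces along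
`E = dx(TM) ⊕ ℝ x` and using Euler's identity for `ζ`, one finds at each point of the hypersurface
`Δ f = tr Dζ`, `‖Hess* f‖² = tr (Dζ ∘ Dζ) - 2 |grad f|²` and `|grad f|² = D²N (ζ, ζ)`
(`Parametrizes.lap_eq`, `Parametrizes.hessStarNormSq_eq`, `Parametrizes.gradSq_eq`).

Now `(tr Dζ)² - tr (Dζ ∘ Dζ)` is a flat divergence. Integrating it by parts against a radial weight
`k(N)` (`integral_mul_trace_sq_sub_of_tsupport_subset`) leaves `-∫ k'(N) D²N (ζ, ζ)`. In polar
coordinates `y = t • x p` Lebesgue measure is the product of `volMeasure` and `t^m dt`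
(`Parametrizes.polarMeasure_eq`), and the degrees of homogeneity `-4` and `-3` of the two integrands
produce the factor `m - 3` (`Parametrizes.integral_trace_sq_sub`). Together with the correction
`2 |grad f|²` this is the constant `m - 1 = n - 2`.

Since `f` is only `C²`, `ζ` is only `C¹` and the integration by parts rests on the weak symmetry of
mixed second derivatives (`integral_fderiv_mul_fderiv_comm`). Strict convexity enters through the
nondegeneracy of `g`, and convexity with an interior origin through the transversality of `x`, which
makes polar coordinates smooth by the inverse function theorem.
-/

open scoped Topology
open Filter MeasureTheory

namespace CentroAffine

/-! ### The Gauss equation and level sets of a function -/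

section Frame

variable {V W : Type*} [NormedAddCommGroup V] [NormedSpace ℝ V]
  [NormedAddCommGroup W] [NormedSpace ℝ W]

theorem frame_apply (X : V → W) (u v : V) (t : ℝ) :
    frame X u (v, t) = fderiv ℝ X u v + t • X u := by
  simp [frame]

/-- The projection of `W` onto `dX(V)` along `X`, read in `V`. -/
noncomputable def tangentPart (X : V → W) (u : V) : W →L[ℝ] V :=
  (ContinuousLinearMap.fst ℝ V ℝ).comp (frame X u).inverse

variable {X : V → W} {u : V}

theorem frame_inverse_fderiv (h : (frame X u).IsInvertible) (v : V) :
    (frame X u).inverse (fderiv ℝ X u v) = (v, 0) := by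
  have := h.inverse_apply_eq (x := (v, (0 : ℝ))) (y := fderiv ℝ X u v)
  rw [this, frame_apply]; simp

theorem frame_inverse_self (h : (frame X u).IsInvertible) :
    (frame X u).inverse (X u) = (0, 1) := by
  have := h.inverse_apply_eq (x := ((0 : V), (1 : ℝ))) (y := X u)
  rw [this, frame_apply]; simp

theorem tangentPart_fderiv (h : (frame X u).IsInvertible) (v : V) :
    tangentPart X u (fderiv ℝ X u v) = v := by
  simp [tangentPart, frame_inverse_fderiv h]

theorem conormal_fderiv (h : (frame X u).IsInvertible) (v : V) :
    conormal X u (fderiv ℝ X u v) = 0 := by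
  simp [conormal, frame_inverse_fderiv h]

theorem conormal_self (h : (frame X u).IsInvertible) : conormal X u (X u) = 1 := by
  simp [conormal, frame_inverse_self h]

theorem frame_decomp (h : (frame X u).IsInvertible) (y : W) :
    y = fderiv ℝ X u (tangentPart X u y) + conormal X u y • X u := by
  have h1 : frame X u ((frame X u).inverse y) = y := by
    rw [h.inverse_apply_eq.1 rfl |>.symm]
  have h2 := frame_apply X u ((frame X u).inverse y).1 ((frame X u).inverse y).2
  rw [Prod.mk.eta, h1] at h2
  exact h2

theorem conormal_eq_of_apply (h : (frame X u).IsInvertible) {l : W →L[ℝ] ℝ}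
    (h0 : ∀ v, l (fderiv ℝ X u v) = 0) (h1 : l (X u) = 1) : conormal X u = l := by
  ext y
  conv_rhs => rw [frame_decomp h y]
  simp [h0, h1]

theorem metric_apply (X : V → W) (u v w : V) :
    metric X u v w = -conormal X u (fderiv ℝ (fderiv ℝ X) u v w) := rfl

theorem christoffel_apply (X : V → W) (u v w : V) :
    christoffel X u v w = tangentPart X u (fderiv ℝ (fderiv ℝ X) u v w) := rfl

theorem gauss_equation (h : (frame X u).IsInvertible) (v w : V) :
    fderiv ℝ (fderiv ℝ X) u v w =
      fderiv ℝ X u (christoffel X u v w) - metric X u v w • X u := by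
  rw [metric_apply, christoffel_apply, neg_smul, sub_neg_eq_add]
  exact frame_decomp h _

/-- The frame of an immersion to which the position vector is transversal is invertible. -/
theorem frame_isInvertible [FiniteDimensional ℝ V] [FiniteDimensional ℝ W]
    (hdim : Module.finrank ℝ W = Module.finrank ℝ V + 1)
    (hinj : ∀ (v : V) (t : ℝ), fderiv ℝ X u v + t • X u = 0 → v = 0 ∧ t = 0) :
    (frame X u).IsInvertible := by
  have hi : Function.Injective (frame X u) := by
    rw [injective_iff_map_eq_zero]
    rintro ⟨v, t⟩ hvt
    rw [frame_apply] at hvt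
    obtain ⟨rfl, rfl⟩ := hinj v t hvt
    rfl
  have hd : Module.finrank ℝ (V × ℝ) = Module.finrank ℝ W := by
    rw [Module.finrank_prod, hdim, Module.finrank_self]
  refine ⟨(LinearEquiv.ofInjectiveOfFinrankEq (frame X u).toLinearMap hi hd).toContinuousLinearEquiv,
    ?_⟩
  ext <;> rfl

end Frame

section Level

variable {V W : Type*} [NormedAddCommGroup V] [NormedSpace ℝ V]
  [NormedAddCommGroup W] [NormedSpace ℝ W]
  {X : V → W} {u : V} {N : W → ℝ}

theorem fderiv_level_apply_fderiv (hX : DifferentiableAt ℝ X u)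
    (hN : DifferentiableAt ℝ N (X u)) (h1 : ∀ᶠ u' in 𝓝 u, N (X u') = 1) (v : V) :
    fderiv ℝ N (X u) (fderiv ℝ X u v) = 0 := by
  have h := (hN.hasFDerivAt.comp u hX.hasFDerivAt).congr_of_eventuallyEq
    (f₁ := fun _ => (1 : ℝ)) (h1.mono fun _ h => h.symm)
  have h2 := h.unique (hasFDerivAt_const (1 : ℝ) u)
  exact congrArg (fun L : V →L[ℝ] ℝ => L v) h2

theorem conormal_eq_fderiv_level (hX : DifferentiableAt ℝ X u)
    (hN : DifferentiableAt ℝ N (X u)) (h1 : ∀ᶠ u' in 𝓝 u, N (X u') = 1)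
    (hinv : (frame X u).IsInvertible) (hE : fderiv ℝ N (X u) (X u) = 1) :
    conormal X u = fderiv ℝ N (X u) :=
  conormal_eq_of_apply hinv (fderiv_level_apply_fderiv hX hN h1) hE

/-- Differentiating a relation `L(u)(Z(u)) = c(u)` between a functional, a vector and a scalar, all
depending on `u`. -/
theorem fderiv_pairing {L : V → W →L[ℝ] ℝ} {Z : V → W} {c : V → ℝ} {c' : V →L[ℝ] ℝ}
    {L' : V →L[ℝ] W →L[ℝ] ℝ} {Z' : V →L[ℝ] W}
    (hL : HasFDerivAt L L' u) (hZ : HasFDerivAt Z Z' u) (hc : HasFDerivAt c c' u)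
    (h : ∀ᶠ u' in 𝓝 u, L u' (Z u') = c u') (v : V) :
    L' v (Z u) + L u (Z' v) = c' v := by
  have h1 := (hL.clm_apply hZ).congr_of_eventuallyEq (f₁ := c) (h.mono fun _ h => h.symm)
  have h2 := congrArg (fun A : V →L[ℝ] ℝ => A v) (h1.unique hc)
  simp at h2
  linarith

/-- The centro-affine metric is the Hessian of the gauge on tangent vectors, by differentiating
`DN (dX w) = 0` along the hypersurface. -/
theorem metric_eq_of_level (hX : ContDiffAt ℝ 2 X u) (hN : ContDiffAt ℝ 2 N (X u))
    (h1 : ∀ᶠ u' in 𝓝 u, N (X u') = 1) (hinv : (frame X u).IsInvertible)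
    (hE : fderiv ℝ N (X u) (X u) = 1) (v w : V) :
    metric X u v w = fderiv ℝ (fderiv ℝ N) (X u) (fderiv ℝ X u v) (fderiv ℝ X u w) := by
  have hXd : DifferentiableAt ℝ X u := hX.differentiableAt (by norm_num)
  have hNd : DifferentiableAt ℝ N (X u) := hN.differentiableAt (by norm_num)
  have hX' : DifferentiableAt ℝ (fderiv ℝ X) u :=
    (hX.fderiv_right (m := 1) (by norm_num)).differentiableAt (by norm_num)
  have hN' : DifferentiableAt ℝ (fderiv ℝ N) (X u) :=
    (hN.fderiv_right (m := 1) (by norm_num)).differentiableAt (by norm_num)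
  have hXe : ∀ᶠ u' in 𝓝 u, DifferentiableAt ℝ X u' :=
    (hX.eventually (by norm_num)).mono fun _ h => h.differentiableAt (by norm_num)
  have hNe : ∀ᶠ u' in 𝓝 u, DifferentiableAt ℝ N (X u') :=
    hXd.continuousAt.eventually
      ((hN.eventually (by norm_num)).mono fun _ h => h.differentiableAt (by norm_num))
  have key := fderiv_pairing (u := u) (L := fun u' => fderiv ℝ N (X u'))
    (Z := fun u' => fderiv ℝ X u' w) (c := fun _ => 0)
    (hN'.hasFDerivAt.comp u hXd.hasFDerivAt)
    (hX'.hasFDerivAt.clm_apply (hasFDerivAt_const w u)) (hasFDerivAt_const 0 u)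
    (by
      filter_upwards [hXe, hNe, h1.eventually_nhds] with u' a b c
      exact fderiv_level_apply_fderiv a b c w) v
  rw [metric_apply, conormal_eq_fderiv_level hXd hNd h1 hinv hE]
  simp at key
  linarith

end Level

/-! ### The gauge gradient in a chart -/

/-- `ζ` is the gradient of the `0`-homogeneous function `F` with respect to the Hessian metric
`D²(N²/2) = N D²N + DN ⊗ DN` of a smooth gauge `N`. Since `F` is `0`-homogeneous, `ζ` is tangent to
the level sets of `N` and homogeneous of degree `-1`; homogeneity is recorded in infinitesimal
form. -/
structure IsGaugeGradient {W : Type*} [NormedAddCommGroup W] [NormedSpace ℝ W]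
    (N F : W → ℝ) (ζ : W → W) : Prop where
  contDiffAt_gauge : ∀ y ≠ 0, ContDiffAt ℝ ∞ N y
  contDiffAt_fun : ∀ y ≠ 0, ContDiffAt ℝ 2 F y
  contDiffAt_grad : ∀ y ≠ 0, ContDiffAt ℝ 1 ζ y
  euler_gauge : ∀ y ≠ 0, fderiv ℝ N y y = N y
  euler_hess : ∀ y ≠ 0, fderiv ℝ (fderiv ℝ N) y y = 0
  hess_pos : ∀ y ≠ 0, ∀ v ≠ 0, fderiv ℝ N y v = 0 → 0 < fderiv ℝ (fderiv ℝ N) y v v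
  tangent : ∀ y ≠ 0, fderiv ℝ N y (ζ y) = 0
  hess_grad : ∀ y ≠ 0, ∀ w, N y * fderiv ℝ (fderiv ℝ N) y (ζ y) w = fderiv ℝ F y w
  euler_grad : ∀ y ≠ 0, fderiv ℝ ζ y y = -ζ y

/-- `X` is, near `u`, a local parametrization of the level set `N = 1` to which the position vector
is transversal. -/
structure IsLevelChart {V W : Type*} [NormedAddCommGroup V] [NormedSpace ℝ V]
    [NormedAddCommGroup W] [NormedSpace ℝ W] (N : W → ℝ) (X : V → W) (u : V) : Prop where
  contDiffAt : ContDiffAt ℝ 2 X u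
  frame : ∀ᶠ u' in 𝓝 u, (frame X u').IsInvertible
  level : ∀ᶠ u' in 𝓝 u, N (X u') = 1

theorem isInvertible_of_pos {V : Type*} [NormedAddCommGroup V] [NormedSpace ℝ V]
    [FiniteDimensional ℝ V] {A : V →L[ℝ] V →L[ℝ] ℝ} (hA : ∀ v ≠ 0, 0 < A v v) :
    A.IsInvertible := by
  let e : (V →ₗ[ℝ] ℝ) ≃ₗ[ℝ] (V →L[ℝ] ℝ) := LinearMap.toContinuousLinearMap
  have hi : Function.Injective A := by
    rw [injective_iff_map_eq_zero]
    intro v hv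
    by_contra hne
    have := hA v hne
    rw [hv] at this
    simp at this
  have hd : Module.finrank ℝ V = Module.finrank ℝ (V →L[ℝ] ℝ) := by
    rw [← e.finrank_eq]
    exact (Subspace.dual_finrank_eq (K := ℝ) (V := V)).symm
  have : FiniteDimensional ℝ (V →L[ℝ] ℝ) := e.finiteDimensional
  refine ⟨(LinearEquiv.ofInjectiveOfFinrankEq A.toLinearMap hi hd).toContinuousLinearEquiv, ?_⟩
  ext; rfl

section LevelChart

variable {V W : Type*} [NormedAddCommGroup V] [NormedSpace ℝ V]
  [NormedAddCommGroup W] [NormedSpace ℝ W]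
  {X : V → W} {u : V} {N F : W → ℝ} {ζ : W → W}

namespace IsLevelChart

theorem eventually (hX : IsLevelChart N X u) : ∀ᶠ u' in 𝓝 u, IsLevelChart N X u' := by
  have h1 := hX.contDiffAt.eventually (by norm_num)
  filter_upwards [h1, hX.frame.eventually_nhds, hX.level.eventually_nhds] with u' a b c
  exact ⟨a, b, c⟩

theorem frame_isInvertible (hX : IsLevelChart N X u) : (CentroAffine.frame X u).IsInvertible :=
  hX.frame.self_of_nhds

theorem differentiableAt (hX : IsLevelChart N X u) : DifferentiableAt ℝ X u :=
  hX.contDiffAt.differentiableAt (by norm_num)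

theorem differentiableAt_fderiv (hX : IsLevelChart N X u) : DifferentiableAt ℝ (fderiv ℝ X) u :=
  (hX.contDiffAt.fderiv_right (m := 1) (by norm_num)).differentiableAt (by norm_num)

theorem ne_zero (hX : IsLevelChart N X u) : X u ≠ 0 := by
  intro h
  have := conormal_self hX.frame_isInvertible
  rw [h] at this
  simp at this

theorem contDiffAt_tangentPart [CompleteSpace V] (hX : IsLevelChart N X u) :
    ContDiffAt ℝ 1 (tangentPart X) u := by
  have h1 : ContDiffAt ℝ 1 (CentroAffine.frame X) u := by
    have e : CentroAffine.frame X = fun u' =>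
        (fderiv ℝ X u').comp (ContinuousLinearMap.fst ℝ V ℝ) +
        (ContinuousLinearMap.smulRightL ℝ (V × ℝ) W (ContinuousLinearMap.snd ℝ V ℝ)) (X u') := by
      funext u'
      ext <;> simp [CentroAffine.frame]
    rw [e]
    refine ContDiffAt.add ?_ ?_
    · exact (hX.contDiffAt.fderiv_right (m := 1) (by norm_num)).clm_comp contDiffAt_const
    · exact (ContinuousLinearMap.contDiff _).contDiffAt.comp u
        (hX.contDiffAt.of_le (by norm_num))
  have h2 : ContDiffAt ℝ 1 (fun u' => (CentroAffine.frame X u').inverse) u :=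
    (hX.frame_isInvertible.contDiffAt_map_inverse).comp u h1
  exact contDiffAt_const.clm_comp h2

end IsLevelChart

namespace IsGaugeGradient

variable (h : IsGaugeGradient N F ζ) (hX : IsLevelChart N X u)
include h hX

theorem fderiv_gauge_self : fderiv ℝ N (X u) (X u) = 1 := by
  rw [h.euler_gauge _ hX.ne_zero, hX.level.self_of_nhds]

theorem conormal_eq : conormal X u = fderiv ℝ N (X u) :=
  conormal_eq_fderiv_level hX.differentiableAt
    ((h.contDiffAt_gauge _ hX.ne_zero).differentiableAt (by norm_num)) hX.level
    hX.frame_isInvertible (h.fderiv_gauge_self hX)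

theorem metric_eq (v w : V) :
    metric X u v w = fderiv ℝ (fderiv ℝ N) (X u) (fderiv ℝ X u v) (fderiv ℝ X u w) :=
  metric_eq_of_level hX.contDiffAt
    ((h.contDiffAt_gauge _ hX.ne_zero).of_le ENat.LEInfty.out) hX.level
    hX.frame_isInvertible (h.fderiv_gauge_self hX) v w

omit hX in
theorem hess_symm {y : W} (hy : y ≠ 0) (v w : W) :
    fderiv ℝ (fderiv ℝ N) y v w = fderiv ℝ (fderiv ℝ N) y w v :=
  ((h.contDiffAt_gauge _ hy).isSymmSndFDerivAt (by simpa using ENat.LEInfty.out)) v w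

omit h in
theorem fderiv_ne_zero {v : V} (hv : v ≠ 0) : fderiv ℝ X u v ≠ 0 := by
  intro h0
  have := tangentPart_fderiv hX.frame_isInvertible v
  rw [h0, map_zero] at this
  exact hv this.symm

theorem fderiv_gauge_fderiv (v : V) : fderiv ℝ N (X u) (fderiv ℝ X u v) = 0 := by
  rw [← h.conormal_eq hX, conormal_fderiv hX.frame_isInvertible]

theorem metric_isInvertible [FiniteDimensional ℝ V] : (metric X u).IsInvertible := by
  refine isInvertible_of_pos fun v hv => ?_
  rw [h.metric_eq hX]
  exact h.hess_pos _ hX.ne_zero _ (fderiv_ne_zero hX hv) (h.fderiv_gauge_fderiv hX v)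

theorem fderiv_tangentPart_of_tangent {y : W} (hy : fderiv ℝ N (X u) y = 0) :
    fderiv ℝ X u (tangentPart X u y) = y := by
  conv_rhs => rw [frame_decomp hX.frame_isInvertible y, h.conormal_eq hX, hy, zero_smul, add_zero]

theorem hasFDerivAt_comp :
    HasFDerivAt (F ∘ X) ((fderiv ℝ F (X u)).comp (fderiv ℝ X u)) u :=
  ((h.contDiffAt_fun _ hX.ne_zero).differentiableAt (by norm_num)).hasFDerivAt.comp u
    hX.differentiableAt.hasFDerivAt

theorem hess_grad_level (w : W) :
    fderiv ℝ (fderiv ℝ N) (X u) (ζ (X u)) w = fderiv ℝ F (X u) w := by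
  rw [← h.hess_grad _ hX.ne_zero, hX.level.self_of_nhds, one_mul]

theorem grad_eq [FiniteDimensional ℝ V] : grad X (F ∘ X) u = tangentPart X u (ζ (X u)) := by
  rw [grad, (h.metric_isInvertible hX).inverse_apply_eq, (h.hasFDerivAt_comp hX).fderiv]
  ext w
  rw [h.metric_eq hX, h.fderiv_tangentPart_of_tangent hX (h.tangent _ hX.ne_zero),
    h.hess_grad_level hX]
  rfl

theorem fderiv_grad [FiniteDimensional ℝ V] : fderiv ℝ X u (grad X (F ∘ X) u) = ζ (X u) := by
  rw [h.grad_eq hX, h.fderiv_tangentPart_of_tangent hX (h.tangent _ hX.ne_zero)]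

theorem gradNormSq_eq [FiniteDimensional ℝ V] :
    gradNormSq X (F ∘ X) u = fderiv ℝ (fderiv ℝ N) (X u) (ζ (X u)) (ζ (X u)) := by
  rw [gradNormSq, h.metric_eq hX, h.fderiv_grad hX]

theorem differentiableAt_grad [FiniteDimensional ℝ V] :
    DifferentiableAt ℝ (grad X (F ∘ X)) u := by
  have h1 : DifferentiableAt ℝ (fun u' => tangentPart X u' (ζ (X u'))) u :=
    ((hX.contDiffAt_tangentPart).differentiableAt (by norm_num)).clm_apply
      (((h.contDiffAt_grad _ hX.ne_zero).differentiableAt (by norm_num)).comp u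
        hX.differentiableAt)
  refine h1.congr_of_eventuallyEq ?_
  filter_upwards [hX.eventually] with u' hu'
  exact h.grad_eq hu'

theorem hasFDerivAt_grad_comp :
    HasFDerivAt (fun u' => ζ (X u')) ((fderiv ℝ ζ (X u)).comp (fderiv ℝ X u)) u :=
  ((h.contDiffAt_grad _ hX.ne_zero).differentiableAt (by norm_num)).hasFDerivAt.comp u
    hX.differentiableAt.hasFDerivAt

/-- The covariant derivative of the gradient is the tangential part of the flat derivative
of `ζ`. -/
theorem covariant_grad [FiniteDimensional ℝ V] :
    fderiv ℝ (grad X (F ∘ X)) u + (christoffel X u).flip (grad X (F ∘ X) u) =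
      (tangentPart X u).comp ((fderiv ℝ ζ (X u)).comp (fderiv ℝ X u)) := by
  have h1 := hX.differentiableAt_fderiv.hasFDerivAt.clm_apply
    (h.differentiableAt_grad hX).hasFDerivAt
  have h2 := h1.unique ((h.hasFDerivAt_grad_comp hX).congr_of_eventuallyEq (by
    filter_upwards [hX.eventually] with u' hu'
    exact h.fderiv_grad hu'))
  rw [← h2]
  ext v
  simp [christoffel_apply, tangentPart_fderiv hX.frame_isInvertible]

/-- The conjugate Hessian is the form which the metric associates with the tangential part of `Dζ`.
This comes from differentiating `⟨dX*(w), ζ⟩ = d(F ∘ X)(w)` along the hypersurface and comparing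
with the Gauss equation of the conormal map. -/
theorem hessStar_eq [FiniteDimensional ℝ V] [FiniteDimensional ℝ W]
    (hdim : Module.finrank ℝ W = Module.finrank ℝ V + 1) (v w : V) :
    hessStar X (F ∘ X) u v w =
      metric X u (tangentPart X u (fderiv ℝ ζ (X u) (fderiv ℝ X u v))) w := by
  have hy := hX.ne_zero
  have hXd := hX.differentiableAt
  -- the conormal map is `DN ∘ X` near `u`
  have hcon : conormal X =ᶠ[𝓝 u] fun u' => fderiv ℝ N (X u') := by
    filter_upwards [hX.eventually] with u' hu'
    exact h.conormal_eq hu'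
  have hN' : ∀ y ≠ 0, HasFDerivAt (fderiv ℝ N) (fderiv ℝ (fderiv ℝ N) y) y := fun y hy =>
    ((h.contDiffAt_gauge y hy).fderiv_right (m := 1) (by norm_num; exact ENat.LEInfty.out)
      |>.differentiableAt (by norm_num)).hasFDerivAt
  have hcon' : fderiv ℝ (conormal X) =ᶠ[𝓝 u]
      fun u' => (fderiv ℝ (fderiv ℝ N) (X u')).comp (fderiv ℝ X u') := by
    filter_upwards [hX.eventually, hcon.eventuallyEq_nhds] with u' hu' hc
    rw [hc.fderiv_eq]
    exact ((hN' _ hu'.ne_zero).comp u' hu'.differentiableAt.hasFDerivAt).fderiv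
  have hd : DifferentiableAt ℝ (fderiv ℝ (conormal X)) u := by
    refine DifferentiableAt.congr_of_eventuallyEq ?_ hcon'
    refine DifferentiableAt.clm_comp ?_ hX.differentiableAt_fderiv
    have : ContDiffAt ℝ 1 (fderiv ℝ (fderiv ℝ N)) (X u) :=
      ((h.contDiffAt_gauge _ hy).fderiv_right (m := 2) (by norm_num; exact ENat.LEInfty.out)).fderiv_right
        (m := 1) (by norm_num)
    exact (this.differentiableAt (by norm_num)).comp u hXd
  -- the frame of the conormal map is invertible
  have hfr : (frame (conormal X) u).IsInvertible := by
    refine frame_isInvertible ?_ ?_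
    · rw [← hdim, ← (LinearMap.toContinuousLinearMap (𝕜 := ℝ) (E := W) (F' := ℝ)).finrank_eq]
      exact Subspace.dual_finrank_eq
    · intro v t hvt
      rw [hcon'.self_of_nhds, hcon.self_of_nhds] at hvt
      have ht : t = 0 := by
        have := congrArg (fun L : W →L[ℝ] ℝ => L (X u)) hvt
        simpa [h.hess_symm hy _ (X u), h.euler_hess _ hy, h.fderiv_gauge_self hX] using this
      refine ⟨?_, ht⟩
      by_contra hv
      have h1 := h.hess_pos _ hy _ (fderiv_ne_zero hX hv) (h.fderiv_gauge_fderiv hX v)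
      have := congrArg (fun L : W →L[ℝ] ℝ => L (fderiv ℝ X u v)) hvt
      simp [ht] at this
      linarith
  have hF' := h.hasFDerivAt_comp hX
  have hFd : HasFDerivAt (fderiv ℝ (F ∘ X)) (fderiv ℝ (fderiv ℝ (F ∘ X)) u) u :=
    (((h.contDiffAt_fun _ hy).comp u hX.contDiffAt).fderiv_right (m := 1)
      (by norm_num) |>.differentiableAt (by norm_num)).hasFDerivAt
  -- `⟨dX*(w), ζ⟩ = dφ(w)`
  have hpair : ∀ᶠ u' in 𝓝 u, ∀ w, fderiv ℝ (conormal X) u' w (ζ (X u')) =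
      fderiv ℝ (F ∘ X) u' w := by
    filter_upwards [hX.eventually, hcon'] with u' hu' hc w
    rw [hc, (h.hasFDerivAt_comp hu').fderiv]
    simp [h.hess_symm hu'.ne_zero _ (ζ (X u')), h.hess_grad_level hu']
  have hdiff := fderiv_pairing (u := u) (L := fun u' => fderiv ℝ (conormal X) u' w)
    (Z := fun u' => ζ (X u')) (c := fun u' => fderiv ℝ (F ∘ X) u' w)
    (hd.hasFDerivAt.clm_apply (hasFDerivAt_const w u)) (h.hasFDerivAt_grad_comp hX)
    (hFd.clm_apply (hasFDerivAt_const w u)) (hpair.mono fun _ h => h w) v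
  simp at hdiff
  have hgauss := congrArg (fun L : W →L[ℝ] ℝ => L (ζ (X u))) (gauss_equation hfr v w)
  simp [hpair.self_of_nhds, hcon.self_of_nhds, h.tangent _ hy] at hgauss
  have hmet : metric X u (tangentPart X u (fderiv ℝ ζ (X u) (fderiv ℝ X u v))) w =
      fderiv ℝ (conormal X) u w (fderiv ℝ ζ (X u) (fderiv ℝ X u v)) := by
    rw [h.metric_eq hX, hcon'.self_of_nhds]
    conv_rhs => rw [frame_decomp hX.frame_isInvertible (fderiv ℝ ζ (X u) (fderiv ℝ X u v))]
    simp [h.hess_symm hy _ (X u), h.euler_hess _ hy, h.hess_symm hy _ (fderiv ℝ X u w)]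
  rw [hmet]
  simp only [hessStar, christoffelStar]
  simp
  linarith

omit hX in
/-- Obtained by differentiating the tangency `DN(ζ) = 0` in the direction `ζ`. -/
theorem fderiv_gauge_fderiv_grad {y : W} (hy : y ≠ 0) :
    fderiv ℝ N y (fderiv ℝ ζ y (ζ y)) = -fderiv ℝ (fderiv ℝ N) y (ζ y) (ζ y) := by
  have hN' : HasFDerivAt (fderiv ℝ N) (fderiv ℝ (fderiv ℝ N) y) y :=
    ((h.contDiffAt_gauge _ hy).fderiv_right (m := 1) (by norm_num; exact ENat.LEInfty.out)
      |>.differentiableAt (by norm_num)).hasFDerivAt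
  have := fderiv_pairing (u := y) (L := fderiv ℝ N) (Z := ζ) (c := fun _ => 0) hN'
    ((h.contDiffAt_grad _ hy).differentiableAt (by norm_num)).hasFDerivAt
    (hasFDerivAt_const 0 _)
    (by filter_upwards [isOpen_ne.mem_nhds hy] with y hy using h.tangent y hy) (ζ y)
  simp at this
  linarith

variable [FiniteDimensional ℝ V] [FiniteDimensional ℝ W]

omit h in
/-- The trace of an endomorphism of `W = dX(V) ⊕ ℝ X` splits into that of its tangential part and
its component along the position vector. -/
theorem trace_tangentPart_comp (S : W →L[ℝ] W) :
    LinearMap.trace ℝ V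
      ((tangentPart X u).comp (S.comp (fderiv ℝ X u)) : V →L[ℝ] V).toLinearMap =
      LinearMap.trace ℝ W S.toLinearMap - conormal X u (S (X u)) := by
  have e1 : ((tangentPart X u).comp (S.comp (fderiv ℝ X u)) : V →L[ℝ] V).toLinearMap =
      (tangentPart X u).toLinearMap ∘ₗ (S.comp (fderiv ℝ X u)).toLinearMap := rfl
  have e2 : (S.comp (fderiv ℝ X u)).toLinearMap ∘ₗ (tangentPart X u).toLinearMap =
      S.toLinearMap - (conormal X u).toLinearMap.smulRight (S (X u)) := by
    ext y
    have := congrArg S (frame_decomp hX.frame_isInvertible y)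
    rw [map_add, map_smul] at this
    simp [this]
  rw [e1, LinearMap.trace_comp_comm', e2, map_sub, LinearMap.trace_smulRight]
  rfl

/-- There is no normal contribution to the trace, since `Dζ (X) = -ζ` is tangent. -/
theorem laplacian_eq :
    laplacian X (F ∘ X) u = LinearMap.trace ℝ W (fderiv ℝ ζ (X u)).toLinearMap := by
  rw [laplacian, divergence, h.covariant_grad hX, trace_tangentPart_comp hX,
    h.euler_grad _ hX.ne_zero, h.conormal_eq hX, map_neg, h.tangent _ hX.ne_zero]
  simp

/-- With `q = DN` at `X`, the squared norm is the trace of the square of the tangential part of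
`Dζ`. Replacing this trace by that of `Dζ ∘ Dζ` on `W` costs the component along `X` twice: each time
it equals `q (Dζ ζ) = -D²N (ζ, ζ)`, because `Dζ X = -ζ`. -/
theorem tensorNormSq_hessStar_eq (hdim : Module.finrank ℝ W = Module.finrank ℝ V + 1) :
    tensorNormSq (metric X u) (hessStar X (F ∘ X) u) =
      LinearMap.trace ℝ W ((fderiv ℝ ζ (X u)).comp (fderiv ℝ ζ (X u))).toLinearMap
        - 2 * fderiv ℝ (fderiv ℝ N) (X u) (ζ (X u)) (ζ (X u)) := by
  set S := fderiv ℝ ζ (X u) with hS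
  set B : V →L[ℝ] V := (tangentPart X u).comp (S.comp (fderiv ℝ X u)) with hB
  have hy := hX.ne_zero
  have hAB : (metric X u).inverse.comp (hessStar X (F ∘ X) u) = B := by
    ext1 v
    rw [ContinuousLinearMap.comp_apply, (h.metric_isInvertible hX).inverse_apply_eq]
    ext w
    exact h.hessStar_eq hX hdim v w
  have hBB : B.comp B = (tangentPart X u).comp
      ((S.comp ((fderiv ℝ X u).comp ((tangentPart X u).comp S))).comp (fderiv ℝ X u)) := rfl
  have hπ : S.comp ((fderiv ℝ X u).comp ((tangentPart X u).comp S)) =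
      S.comp S - ((conormal X u).comp S).smulRight (S (X u)) := by
    ext y
    have := congrArg S (frame_decomp hX.frame_isInvertible (S y))
    rw [map_add, map_smul] at this
    simp [this]
  have hq := h.fderiv_gauge_fderiv_grad hy
  rw [← hS] at hq
  have hSx : S (X u) = -ζ (X u) := h.euler_grad _ hy
  rw [tensorNormSq, hAB, hBB, trace_tangentPart_comp hX, hπ]
  have e3 : (S.comp S - ((conormal X u).comp S).smulRight (S (X u))).toLinearMap =
      (S.comp S).toLinearMap - ((conormal X u).comp S).toLinearMap.smulRight (S (X u)) := rfl
  rw [e3, map_sub, LinearMap.trace_smulRight]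
  simp [h.conormal_eq hX, hSx, hq, h.tangent _ hy]
  ring

end IsGaugeGradient

end LevelChart

/-! ### Integration by parts for fields of class `C¹` -/

section ByParts

variable {W : Type*} [NormedAddCommGroup W] [NormedSpace ℝ W] 
theorem trace_eq_sum_repr {ι : Type*} [Fintype ι] (b : Module.Basis ι ℝ W) (S : W →ₗ[ℝ] W) :
    LinearMap.trace ℝ W S = ∑ i, b.repr (S (b i)) i := by
  classical
  simp [LinearMap.trace_eq_matrix_trace ℝ b, Matrix.trace, LinearMap.toMatrix_apply]

theorem trace_comp_self_eq_sum_repr {ι : Type*} [Fintype ι] (b : Module.Basis ι ℝ W)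
    (S : W →ₗ[ℝ] W) :
    LinearMap.trace ℝ W (S ∘ₗ S) = ∑ i, ∑ j, b.repr (S (b j)) i * b.repr (S (b i)) j := by
  classical
  rw [LinearMap.trace_eq_matrix_trace ℝ b, LinearMap.toMatrix_comp b b b]
  simp [Matrix.trace, LinearMap.toMatrix_apply, Matrix.mul_apply]

variable [FiniteDimensional ℝ W]

/-- A function of class `C¹` on an open set agrees near a given compact subset with a compactly
supported function of class `C¹`. -/
theorem exists_contDiff_eventuallyEq {V' : Type*} [NormedAddCommGroup V'] [NormedSpace ℝ V']
    {O S : Set W} (hO : IsOpen O) (hS : IsCompact S) (hSO : S ⊆ O) {ζ : W → V'}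
    (hζ : ∀ y ∈ O, ContDiffAt ℝ 1 ζ y) :
    ∃ η : W → V', ContDiff ℝ 1 η ∧ HasCompactSupport η ∧ ∀ y ∈ S, η =ᶠ[𝓝 y] ζ := by
  obtain ⟨T, hT, hST, hTO⟩ := exists_compact_between hS hO hSO
  obtain ⟨χ, h1, h0, -⟩ := exists_contMDiffMap_one_nhds_of_subset_interior 𝓘(ℝ, W) (n := 1)
    hS.isClosed hST
  have hsupp : tsupport χ ⊆ T := by
    refine closure_minimal (fun y hy => ?_) hT.isClosed
    by_contra hyT
    exact hy (h0 y hyT)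
  have hχ : ContDiff ℝ 1 χ := χ.contMDiff.contDiff
  have hts : tsupport (fun y => χ y • ζ y) ⊆ T := (tsupport_smul_subset_left _ _).trans hsupp
  refine ⟨fun y => χ y • ζ y, ?_, hT.of_isClosed_subset (isClosed_tsupport _) hts, ?_⟩
  · rw [contDiff_iff_contDiffAt]
    intro y
    by_cases hy : y ∈ O
    · exact hχ.contDiffAt.smul (hζ y hy)
    · have hy' : y ∉ tsupport (fun y => χ y • ζ y) := fun h => hy (hTO (hts h))
      exact contDiffAt_const (c := (0 : V')) |>.congr_of_eventuallyEq
        (notMem_tsupport_iff_eventuallyEq.1 hy')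
  · intro y hy
    filter_upwards [h1.filter_mono (nhds_le_nhdsSet hy)] with z hz
    rw [hz, one_smul]

variable [MeasurableSpace W] [BorelSpace W] {μ : Measure W} [μ.IsAddHaarMeasure]

/-- Mixed second derivatives commute in the weak sense. For functions of class `C¹` this follows
by replacing one derivative by a difference quotient. -/
theorem integral_fderiv_mul_fderiv_comm {φ ψ : W → ℝ} (hφ : ContDiff ℝ 1 φ) (hψ : ContDiff ℝ 1 ψ)
    (hφc : HasCompactSupport φ) (hψc : HasCompactSupport ψ) (a b : W) :
    ∫ y, fderiv ℝ φ y a * fderiv ℝ ψ y b ∂μ = ∫ y, fderiv ℝ φ y b * fderiv ℝ ψ y a ∂μ := by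
  have hφ' : ∀ v, Continuous fun y => fderiv ℝ φ y v := fun v =>
    (hφ.continuous_fderiv (by norm_num)).clm_apply continuous_const
  have hψ' : ∀ v, Continuous fun y => fderiv ℝ ψ y v := fun v =>
    (hψ.continuous_fderiv (by norm_num)).clm_apply continuous_const
  have hφd : Differentiable ℝ φ := hφ.differentiable (by norm_num)
  have hψd : Differentiable ℝ ψ := hψ.differentiable (by norm_num)
  obtain ⟨C, hC⟩ := ContDiff.lipschitzWith_of_hasCompactSupport hφc hφ (by norm_num)
  obtain ⟨D, hD⟩ := ContDiff.lipschitzWith_of_hasCompactSupport hψc hψ (by norm_num)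
  have hψc' : ∀ v, HasCompactSupport fun y => fderiv ℝ ψ y v := fun v => hψc.fderiv_apply ℝ v
  have int_mul : ∀ {f g : W → ℝ}, Continuous f → Continuous g → HasCompactSupport g →
      Integrable (fun y => f y * g y) μ := fun hf hg hgc =>
    (hf.mul hg).integrable_of_hasCompactSupport hgc.mul_left
  have h1 := hC.integral_inv_smul_sub_mul_tendsto_integral_lineDeriv_mul' (μ := μ) hφc (hψ' b) a
  have h2 := hD.integral_inv_smul_sub_mul_tendsto_integral_lineDeriv_mul' (μ := μ) hψc (hφ' b) (-a)
  -- The difference quotient of `φ` in the direction `a` is of class `C¹`, so the derivative in the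
  -- direction `b` can be moved onto it, and translation moves the difference quotient onto `ψ`.
  have key : ∀ t : ℝ, ∫ y, (t⁻¹ • (φ (y + t • a) - φ y)) * fderiv ℝ ψ y b ∂μ =
      -∫ y, (t⁻¹ • (ψ (y + t • -a) - ψ y)) * fderiv ℝ φ y b ∂μ := by
    intro t
    have hsh : Differentiable ℝ fun y => φ (y + t • a) := hφd.comp (differentiable_id.add_const _)
    have hshd : ∀ y, fderiv ℝ (fun y => φ (y + t • a)) y = fderiv ℝ φ (y + t • a) := fun y =>
      fderiv_comp_add_right _
    have hp1 : ∫ y, φ (y + t • a) * fderiv ℝ ψ y b ∂μ =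
        -∫ y, fderiv ℝ φ (y + t • a) b * ψ y ∂μ := by
      rw [integral_mul_fderiv_eq_neg_fderiv_mul_of_integrable]
      · simp_rw [hshd]
      · simp_rw [hshd]
        exact int_mul ((hφ' b).comp (continuous_id.add continuous_const)) hψ.continuous hψc
      · exact int_mul hsh.continuous (hψ' b) (hψc' b)
      · exact int_mul hsh.continuous hψ.continuous hψc
      · exact fun x _ => hsh x
      · exact fun x _ => hψd x
    have hp2 : ∫ y, φ y * fderiv ℝ ψ y b ∂μ = -∫ y, fderiv ℝ φ y b * ψ y ∂μ := by
      rw [integral_mul_fderiv_eq_neg_fderiv_mul_of_integrable]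
      · exact int_mul (hφ' b) hψ.continuous hψc
      · exact int_mul hφ.continuous (hψ' b) (hψc' b)
      · exact int_mul hφ.continuous hψ.continuous hψc
      · exact fun x _ => hφd x
      · exact fun x _ => hψd x
    have hp3 : ∫ y, fderiv ℝ φ (y + t • a) b * ψ y ∂μ =
        ∫ y, fderiv ℝ φ y b * ψ (y + t • -a) ∂μ := by
      rw [← integral_add_right_eq_self (fun y => fderiv ℝ φ y b * ψ (y + t • -a)) (t • a)]
      simp [add_assoc]
    have e1 : ∫ y, (t⁻¹ • (φ (y + t • a) - φ y)) * fderiv ℝ ψ y b ∂μ =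
        t⁻¹ * (∫ y, φ (y + t • a) * fderiv ℝ ψ y b ∂μ - ∫ y, φ y * fderiv ℝ ψ y b ∂μ) := by
      rw [← integral_sub (int_mul hsh.continuous (hψ' b) (hψc' b))
        (int_mul hφ.continuous (hψ' b) (hψc' b)), ← integral_const_mul]
      congr 1; ext y; simp only [smul_eq_mul]; ring
    have hψs : Continuous fun y => ψ (y + t • -a) :=
      hψ.continuous.comp (continuous_id.add continuous_const)
    have hψsc : HasCompactSupport fun y => ψ (y + t • -a) :=
      hψc.comp_homeomorph (Homeomorph.addRight (t • -a))
    have e2 : ∫ y, (t⁻¹ • (ψ (y + t • -a) - ψ y)) * fderiv ℝ φ y b ∂μ =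
        t⁻¹ * (∫ y, fderiv ℝ φ y b * ψ (y + t • -a) ∂μ - ∫ y, fderiv ℝ φ y b * ψ y ∂μ) := by
      rw [← integral_sub (int_mul (hφ' b) hψs hψsc)
        (int_mul (hφ' b) hψ.continuous hψc), ← integral_const_mul]
      congr 1; ext y; simp only [smul_eq_mul]; ring
    rw [e1, e2, hp1, hp2, hp3]; ring
  simp_rw [key] at h1
  have h3 := tendsto_nhds_unique h1 h2.neg
  simp_rw [(hφd _).lineDeriv_eq_fderiv, (hψd _).lineDeriv_eq_fderiv] at h3
  rw [h3, ← integral_neg]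
  congr 1; ext y; simp; ring

/-- Integration by parts for `(tr Dζ)² - tr (Dζ ∘ Dζ)`, which is a flat divergence. The field `ζ` is
only of class `C¹`. -/
theorem integral_mul_trace_sq_sub {w : W → ℝ} {ζ : W → W} (hw : ContDiff ℝ 1 w)
    (hζ : ContDiff ℝ 1 ζ) (hwc : HasCompactSupport w) (hζc : HasCompactSupport ζ) :
    ∫ y, w y * (LinearMap.trace ℝ W (fderiv ℝ ζ y).toLinearMap ^ 2 -
        LinearMap.trace ℝ W ((fderiv ℝ ζ y).comp (fderiv ℝ ζ y)).toLinearMap) ∂μ =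
      ∫ y, (fderiv ℝ w y (fderiv ℝ ζ y (ζ y)) -
        fderiv ℝ w y (ζ y) * LinearMap.trace ℝ W (fderiv ℝ ζ y).toLinearMap) ∂μ := by
  let b := Module.finBasis ℝ W
  let C : Fin (Module.finrank ℝ W) → W →L[ℝ] ℝ := fun i => (b.coord i).toContinuousLinearMap
  have hζd : Differentiable ℝ ζ := hζ.differentiable (by norm_num)
  have hwd : Differentiable ℝ w := hw.differentiable (by norm_num)
  have hc : ∀ i, ContDiff ℝ 1 fun y => C i (ζ y) := fun i => (C i).contDiff.comp hζ
  have hcc : ∀ i, HasCompactSupport fun y => C i (ζ y) := fun i =>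
    hζc.comp_left (g := C i) (map_zero _)
  have hcd : ∀ i y v, fderiv ℝ (fun y => C i (ζ y)) y v = C i (fderiv ℝ ζ y v) := fun i y v => by
    rw [HasFDerivAt.fderiv (f := fun y => C i (ζ y))
      ((C i).hasFDerivAt.comp y (hζd y).hasFDerivAt)]
    rfl
  have hp : ∀ i, ContDiff ℝ 1 fun y => w y * C i (ζ y) := fun i => hw.mul (hc i)
  have hpc : ∀ i, HasCompactSupport fun y => w y * C i (ζ y) := fun i => (hcc i).mul_left
  have hpd : ∀ i y v, fderiv ℝ (fun y => w y * C i (ζ y)) y v =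
      w y * C i (fderiv ℝ ζ y v) + fderiv ℝ w y v * C i (ζ y) := fun i y v => by
    rw [fderiv_fun_mul (hwd y) ((hc i).differentiable (by norm_num) y)]
    simp [hcd]; ring
  -- the difference of the two integrands
  let T : Fin (Module.finrank ℝ W) → Fin (Module.finrank ℝ W) → W → ℝ := fun i j y =>
    fderiv ℝ (fun y => w y * C i (ζ y)) y (b i) * fderiv ℝ (fun y => C j (ζ y)) y (b j) -
    fderiv ℝ (fun y => w y * C i (ζ y)) y (b j) * fderiv ℝ (fun y => C j (ζ y)) y (b i)
  have hint : ∀ i j v v', Integrable (fun y => fderiv ℝ (fun y => w y * C i (ζ y)) y v *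
      fderiv ℝ (fun y => C j (ζ y)) y v') μ := fun i j v v' =>
    (((hp i).continuous_fderiv (by norm_num)).clm_apply continuous_const |>.mul
      (((hc j).continuous_fderiv (by norm_num)).clm_apply continuous_const))
      |>.integrable_of_hasCompactSupport ((hcc j).fderiv_apply ℝ v').mul_left
  have hTint : ∀ i j, Integrable (T i j) μ := fun i j => (hint i j _ _).sub (hint i j _ _)
  have hT : ∫ y, ∑ i, ∑ j, T i j y ∂μ = 0 := by
    rw [integral_finsetSum _ fun i _ => integrable_finsetSum _ fun j _ => hTint i j]
    refine Finset.sum_eq_zero fun i _ => ?_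
    rw [integral_finsetSum _ fun j _ => hTint i j]
    refine Finset.sum_eq_zero fun j _ => ?_
    simp only [T]
    rw [integral_sub (hint i j _ _) (hint i j _ _),
      integral_fderiv_mul_fderiv_comm (hp i) (hc j) (hpc i) (hcc j), sub_self]
  have hpt : ∀ y, w y * (LinearMap.trace ℝ W (fderiv ℝ ζ y).toLinearMap ^ 2 -
        LinearMap.trace ℝ W ((fderiv ℝ ζ y).comp (fderiv ℝ ζ y)).toLinearMap) =
      (fderiv ℝ w y (fderiv ℝ ζ y (ζ y)) -
        fderiv ℝ w y (ζ y) * LinearMap.trace ℝ W (fderiv ℝ ζ y).toLinearMap) +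
      ∑ i, ∑ j, T i j y := by
    intro y
    have hz : ∑ i, C i (ζ y) • b i = ζ y := b.sum_repr (ζ y)
    have e1 : fderiv ℝ w y (ζ y) = ∑ i, C i (ζ y) * fderiv ℝ w y (b i) := by
      conv_lhs => rw [← hz]
      simp
    have e2 : fderiv ℝ w y (fderiv ℝ ζ y (ζ y)) =
        ∑ i, ∑ j, C i (ζ y) * (C j (fderiv ℝ ζ y (b i)) * fderiv ℝ w y (b j)) := by
      have h2 : ∀ i, fderiv ℝ w y (fderiv ℝ ζ y (b i)) =
          ∑ j, C j (fderiv ℝ ζ y (b i)) * fderiv ℝ w y (b j) := fun i => by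
        conv_lhs => rw [← b.sum_repr (fderiv ℝ ζ y (b i)), map_sum]
        simp [C]
      conv_lhs => rw [← hz]
      simp [h2, Finset.mul_sum]
    have e3 : LinearMap.trace ℝ W (fderiv ℝ ζ y).toLinearMap = ∑ i, C i (fderiv ℝ ζ y (b i)) :=
      trace_eq_sum_repr b _
    have e4 : LinearMap.trace ℝ W ((fderiv ℝ ζ y).comp (fderiv ℝ ζ y)).toLinearMap =
        ∑ i, ∑ j, C i (fderiv ℝ ζ y (b j)) * C j (fderiv ℝ ζ y (b i)) :=
      trace_comp_self_eq_sum_repr b _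
    rw [e1, e2, e3, e4, sq, Finset.sum_mul_sum, Finset.sum_mul_sum, ← Finset.sum_sub_distrib,
      Finset.mul_sum, ← Finset.sum_sub_distrib, ← Finset.sum_add_distrib]
    refine Finset.sum_congr rfl fun i _ => ?_
    rw [← Finset.sum_sub_distrib, Finset.mul_sum, ← Finset.sum_sub_distrib,
      ← Finset.sum_add_distrib]
    refine Finset.sum_congr rfl fun j _ => ?_
    simp only [T, hcd, hpd]
    ring
  simp_rw [hpt]
  rw [integral_add _ (integrable_finsetSum _ fun i _ => integrable_finsetSum _ fun j _ =>
      hTint i j), hT, add_zero]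
  have hw' : ∀ {g : W → W}, Continuous g → Continuous fun y => fderiv ℝ w y (g y) := fun hg =>
    (hw.continuous_fderiv (by norm_num)).clm_apply hg
  have hζ' := hζ.continuous_fderiv (by norm_num)
  have hw0 : ∀ y, y ∉ tsupport w → fderiv ℝ w y = 0 := fun y hy =>
    image_eq_zero_of_notMem_tsupport fun h => hy (tsupport_fderiv_subset ℝ h)
  refine Continuous.integrable_of_hasCompactSupport ?_ ?_
  · refine (hw' (hζ'.clm_apply hζ.continuous)).sub ((hw' hζ.continuous).mul ?_)
    have : (fun y => LinearMap.trace ℝ W (fderiv ℝ ζ y).toLinearMap) =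
        fun y => ∑ i, C i (fderiv ℝ ζ y (b i)) := by
      funext y; exact trace_eq_sum_repr b _
    rw [this]
    exact continuous_finsetSum _ fun i _ =>
      (C i).continuous.comp (hζ'.clm_apply continuous_const)
  · refine HasCompactSupport.intro hwc fun y hy => ?_
    simp [hw0 y hy]

/-- The same formula when `ζ` is only defined on an open set containing the support of the
weight. -/
theorem integral_mul_trace_sq_sub_of_tsupport_subset {O : Set W} (hO : IsOpen O) {w : W → ℝ}
    {ζ : W → W} (hw : ContDiff ℝ 1 w) (hwc : HasCompactSupport w) (hwO : tsupport w ⊆ O)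
    (hζ : ∀ y ∈ O, ContDiffAt ℝ 1 ζ y) :
    ∫ y, w y * (LinearMap.trace ℝ W (fderiv ℝ ζ y).toLinearMap ^ 2 -
        LinearMap.trace ℝ W ((fderiv ℝ ζ y).comp (fderiv ℝ ζ y)).toLinearMap) ∂μ =
      ∫ y, (fderiv ℝ w y (fderiv ℝ ζ y (ζ y)) -
        fderiv ℝ w y (ζ y) * LinearMap.trace ℝ W (fderiv ℝ ζ y).toLinearMap) ∂μ := by
  obtain ⟨η, hη, hηc, hηζ⟩ := exists_contDiff_eventuallyEq hO hwc hwO hζ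
  have hmain := integral_mul_trace_sq_sub (μ := μ) hw hη hwc hηc
  have hw0 : ∀ y, y ∉ tsupport w → fderiv ℝ w y = 0 := fun y hy =>
    image_eq_zero_of_notMem_tsupport fun h => hy (tsupport_fderiv_subset ℝ h)
  convert hmain using 3 with y y
  · by_cases hy : y ∈ tsupport w
    · rw [(hηζ y hy).fderiv_eq]
    · rw [image_eq_zero_of_notMem_tsupport hy, zero_mul, zero_mul]
  · by_cases hy : y ∈ tsupport w
    · rw [(hηζ y hy).fderiv_eq, (hηζ y hy).self_of_nhds]
    · simp [hw0 y hy]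

end ByParts

/-! ### Homogeneous functions and the gauge gradient -/

section Homogeneous

variable {W V' : Type*} [NormedAddCommGroup W] [NormedSpace ℝ W]
  [NormedAddCommGroup V'] [NormedSpace ℝ V']

/-- `g` is positively homogeneous of degree `k`. -/
def IsHomogeneous (k : ℤ) (g : W → V') : Prop :=
  ∀ t : ℝ, 0 < t → ∀ y, g (t • y) = t ^ k • g y

theorem IsHomogeneous.fderiv {k : ℤ} {g : W → V'} (hg : IsHomogeneous k g) :
    IsHomogeneous (k - 1) (fderiv ℝ g) := by
  intro t ht y
  have h1 : (fun y => g (t • y)) = t ^ k • g := funext (hg t ht)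
  have h2 := congrArg (fun h => _root_.fderiv ℝ h y) h1
  rw [fderiv_comp_smul, fderiv_const_smul_field, Pi.smul_apply] at h2
  rw [zpow_sub_one₀ ht.ne', mul_comm, mul_smul, ← h2, inv_smul_smul₀ ht.ne']

/-- Euler's identity. -/
theorem IsHomogeneous.fderiv_apply_self {k : ℤ} {g : W → V'} (hg : IsHomogeneous k g) {y : W}
    (hd : DifferentiableAt ℝ g y) : _root_.fderiv ℝ g y y = (k : ℝ) • g y := by
  have h1 : HasDerivAt (fun t : ℝ => g (t • y)) (_root_.fderiv ℝ g y y) 1 := by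
    have hs : HasDerivAt (fun t : ℝ => t • y) y 1 := by
      simpa using (hasDerivAt_id (1 : ℝ)).smul_const y
    have hd' : HasFDerivAt g (_root_.fderiv ℝ g y) ((1 : ℝ) • y) := by
      rw [one_smul]; exact hd.hasFDerivAt
    exact hd'.comp_hasDerivAt 1 hs
  have h2 : HasDerivAt (fun t : ℝ => t ^ k • g y) ((k : ℝ) • g y) 1 := by
    simpa using (hasDerivAt_zpow k (1 : ℝ) (Or.inl one_ne_zero)).smul_const (g y)
  refine h1.unique (h2.congr_of_eventuallyEq ?_)
  filter_upwards [lt_mem_nhds (zero_lt_one : (0 : ℝ) < 1)] with t ht using hg t ht y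

end Homogeneous

section GaugeGradient

variable {W : Type*} [NormedAddCommGroup W] [NormedSpace ℝ W]

/-- The Hessian metric `D²(N²/2)` of a gauge `N`. -/
noncomputable def gaugeMetric (N : W → ℝ) (y : W) : W →L[ℝ] W →L[ℝ] ℝ :=
  N y • fderiv ℝ (fderiv ℝ N) y + (fderiv ℝ N y).smulRight (fderiv ℝ N y)

/-- The gradient of `F` with respect to `D²(N²/2)`. -/
noncomputable def gaugeGradient (N F : W → ℝ) (y : W) : W :=
  (gaugeMetric N y).inverse (fderiv ℝ F y)

variable {N F : W → ℝ}

theorem gaugeMetric_apply (N : W → ℝ) (y v w : W) : gaugeMetric N y v w =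
    N y * fderiv ℝ (fderiv ℝ N) y v w + fderiv ℝ N y v * fderiv ℝ N y w := by
  simp [gaugeMetric]

theorem gaugeMetric_smul (hN : IsHomogeneous 1 N) {t : ℝ} (ht : 0 < t) (y : W) :
    gaugeMetric N (t • y) = gaugeMetric N y := by
  ext v w
  rw [gaugeMetric_apply, gaugeMetric_apply, hN t ht, hN.fderiv t ht, hN.fderiv.fderiv t ht]
  have : t ≠ 0 := ht.ne'
  simp
  field_simp

theorem gaugeGradient_isHomogeneous (hN : IsHomogeneous 1 N) (hF : IsHomogeneous 0 F) :
    IsHomogeneous (-1) (gaugeGradient N F) := by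
  intro t ht y
  rw [gaugeGradient, gaugeGradient, gaugeMetric_smul hN ht, hF.fderiv t ht, map_smul, zero_sub]

set_option maxSynthPendingDepth 3 in
/-- The Hessian metric `DN ⊗ DN + N D²N` is positive definite away from the origin, so its inverse
produces a field of class `C¹`; tangency to the level sets follows from Euler's identity for `F`. -/
theorem gaugeGradient_isGaugeGradient [FiniteDimensional ℝ W]
    (hN : IsHomogeneous 1 N) (hF : IsHomogeneous 0 F)
    (hNs : ∀ y ≠ 0, ContDiffAt ℝ ∞ N y) (hFs : ∀ y ≠ 0, ContDiffAt ℝ 2 F y)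
    (hpos : ∀ y ≠ 0, 0 < N y)
    (hhess : ∀ y ≠ 0, ∀ v ≠ 0, fderiv ℝ N y v = 0 → 0 < fderiv ℝ (fderiv ℝ N) y v v) :
    IsGaugeGradient N F (gaugeGradient N F) := by
  have hN1 : ∀ y ≠ 0, fderiv ℝ N y y = N y := fun y hy => by
    simpa using hN.fderiv_apply_self ((hNs y hy).differentiableAt (by simp))
  have hN' : ∀ y ≠ 0, ContDiffAt ℝ 2 (fderiv ℝ N) y := fun y hy =>
    (hNs y hy).fderiv_right (by norm_num; exact ENat.LEInfty.out)
  have hN2 : ∀ y ≠ 0, fderiv ℝ (fderiv ℝ N) y y = 0 := fun y hy => by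
    simpa using hN.fderiv.fderiv_apply_self ((hN' y hy).differentiableAt (by simp))
  have hsymm : ∀ y ≠ 0, ∀ v w, fderiv ℝ (fderiv ℝ N) y v w = fderiv ℝ (fderiv ℝ N) y w v :=
    fun y hy v w => (hNs y hy).isSymmSndFDerivAt (by simpa using ENat.LEInfty.out) v w
  have hinv : ∀ y ≠ 0, (gaugeMetric N y).IsInvertible := by
    intro y hy
    refine isInvertible_of_pos fun v hv => ?_
    rw [gaugeMetric_apply]
    have hp := hpos y hy
    set s := fderiv ℝ N y v / N y with hs
    set w := v - s • y with hw
    have hvw : v = w + s • y := by simp [hw]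
    have hDw : fderiv ℝ N y w = 0 := by
      rw [hw, map_sub, map_smul, hN1 y hy, hs, smul_eq_mul, div_mul_cancel₀ _ hp.ne', sub_self]
    have h2 : fderiv ℝ (fderiv ℝ N) y v v = fderiv ℝ (fderiv ℝ N) y w w := by
      rw [hvw]
      simp [hN2 y hy, hsymm y hy w y]
    rw [h2]
    by_cases hw0 : w = 0
    · have hs0 : s ≠ 0 := by
        intro h; rw [hw0, h] at hvw; simp at hvw; exact hv hvw
      have : fderiv ℝ N y v ≠ 0 := fun h => hs0 (by rw [hs, h, zero_div])
      rw [hw0]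
      simp
      positivity
    · have := hhess y hy w hw0 hDw
      have h3 := mul_self_nonneg (fderiv ℝ N y v)
      positivity
  have hG : ∀ y ≠ 0, ∀ w, gaugeMetric N y (gaugeGradient N F y) w = fderiv ℝ F y w := by
    intro y hy w
    have := ((hinv y hy).inverse_apply_eq (x := gaugeGradient N F y) (y := fderiv ℝ F y)).1 rfl
    rw [← this]
  have htan : ∀ y ≠ 0, fderiv ℝ N y (gaugeGradient N F y) = 0 := by
    intro y hy
    have h1 := hG y hy y
    have h2 : fderiv ℝ F y y = 0 := by
      simpa using hF.fderiv_apply_self ((hFs y hy).differentiableAt (by simp))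
    rw [gaugeMetric_apply, hsymm y hy _ y, hN2 y hy, hN1 y hy, h2] at h1
    simpa [(hpos y hy).ne'] using h1
  have hζs : ∀ y ≠ 0, ContDiffAt ℝ 1 (gaugeGradient N F) y := by
    intro y hy
    have hG1 : ContDiffAt ℝ 1 (gaugeMetric N) y := by
      refine ContDiffAt.add ?_ ?_
      · have h1 : ContDiffAt ℝ 1 (fderiv ℝ (fderiv ℝ N)) y :=
          (hN' y hy).fderiv_right (by norm_num)
        have h2 : ContDiffAt ℝ 1 N y := (hNs y hy).of_le ENat.LEInfty.out
        exact h2.smul h1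
      · have := (hN' y hy).of_le (m := 1) (by norm_num)
        exact this.smulRight this
    have hi : ContDiffAt ℝ 1 (fun y => (gaugeMetric N y).inverse) y :=
      ((hinv y hy).contDiffAt_map_inverse).comp y hG1
    exact hi.clm_apply ((hFs y hy).fderiv_right (by norm_num))
  refine ⟨hNs, hFs, hζs, hN1, hN2, hhess, htan, ?_, ?_⟩
  · intro y hy w
    rw [← hG y hy w, gaugeMetric_apply, htan y hy]; simp
  · intro y hy
    simpa using (gaugeGradient_isHomogeneous hN hF).fderiv_apply_self
      ((hζs y hy).differentiableAt (by simp))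

end GaugeGradient

/-! ### Convexity, transversality and polar coordinates near a point -/

section ConvexBody

variable {V W : Type*} [NormedAddCommGroup V] [NormedSpace ℝ V]
  [NormedAddCommGroup W] [NormedSpace ℝ W]
  {K : ConvexBody W}

namespace SmoothPosCurved

theorem nhds_zero (hK : SmoothPosCurved K) : (K : Set W) ∈ 𝓝 0 :=
  mem_interior_iff_mem_nhds.1 hK.zero_mem

theorem gauge_pos (hK : SmoothPosCurved K) {y : W} (hy : y ≠ 0) : 0 < gauge (K : Set W) y :=
  (_root_.gauge_pos (absorbent_nhds_zero hK.nhds_zero)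
    ((NormedSpace.isVonNBounded_iff ℝ).2 K.isCompact.isBounded)).2 hy

theorem gauge_isHomogeneous (K : ConvexBody W) : IsHomogeneous 1 (gauge (K : Set W)) := by
  intro t ht y
  rw [gauge_smul_of_nonneg ht.le, zpow_one]

theorem gauge_eq_one_iff (hK : SmoothPosCurved K) {y : W} :
    gauge (K : Set W) y = 1 ↔ y ∈ frontier (K : Set W) :=
  gauge_eq_one_iff_mem_frontier K.convex hK.nhds_zero

/-- The differential `l` at `X u` of a defining function of `K` is positive on the position vector
(as `0` is interior), vanishes on the tangent space, and detects the curvature. -/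
theorem exists_supporting (hK : SmoothPosCurved K) {X : V → W} {u : V} (hX : ContDiffAt ℝ 2 X u)
    (hinj : Function.Injective (fderiv ℝ X u))
    (hfr : ∀ᶠ u' in 𝓝 u, X u' ∈ frontier (K : Set W)) :
    ∃ l : W →L[ℝ] ℝ, 0 < l (X u) ∧ (∀ v, l (fderiv ℝ X u v) = 0) ∧
      ∀ v ≠ 0, l (fderiv ℝ (fderiv ℝ X) u v v) < 0 := by
  obtain ⟨U, ρ, hU, hyU, hρ, hρK, hρ0, hρ2⟩ := hK.boundary (X u) hfr.self_of_nhds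
  have hclosed : IsClosed (K : Set W) := K.isClosed
  have hρs : ∀ z ∈ U, ContDiffAt ℝ ∞ ρ z := fun z hz => hρ.contDiffAt (hU.mem_nhds hz)
  have hρfr : ∀ z ∈ U, z ∈ frontier (K : Set W) → ρ z = 0 := by
    intro z hz hzf
    have hzK : z ∈ (K : Set W) := hclosed.frontier_subset hzf
    refine le_antisymm ((hρK z hz).1 hzK) (not_lt.1 fun hlt => hzf.2 ?_)
    rw [mem_interior_iff_mem_nhds]
    filter_upwards [hU.mem_nhds hz, (hρs z hz).continuousAt.eventually_lt_const hlt] with z' h1 h2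
    exact (hρK z' h1).2 h2.le
  have hXc : ContinuousAt X u := hX.continuousAt
  have hXU : ∀ᶠ u' in 𝓝 u, X u' ∈ U := hXc.eventually (hU.mem_nhds hyU)
  have hρX : ∀ᶠ u' in 𝓝 u, ρ (X u') = 0 := by
    filter_upwards [hXU, hfr] with u' h1 h2 using hρfr _ h1 h2
  have hXd : ∀ᶠ u' in 𝓝 u, DifferentiableAt ℝ X u' :=
    (hX.eventually (by norm_num)).mono fun _ h => h.differentiableAt (by norm_num)
  have hρd : ∀ z ∈ U, DifferentiableAt ℝ ρ z := fun z hz =>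
    (hρs z hz).differentiableAt (by norm_num)
  have htan : ∀ᶠ u' in 𝓝 u, ∀ v, fderiv ℝ ρ (X u') (fderiv ℝ X u' v) = 0 := by
    filter_upwards [hXU, hXd, hρX.eventually_nhds] with u' h1 h2 h3 v
    have e1 := ((hρd _ h1).hasFDerivAt.comp u' h2.hasFDerivAt).congr_of_eventuallyEq
      (f₁ := fun _ => (0 : ℝ)) (h3.mono fun _ h => h.symm)
    exact congrArg (fun L : V →L[ℝ] ℝ => L v) (e1.unique (hasFDerivAt_const (0 : ℝ) u'))
  refine ⟨fderiv ℝ ρ (X u), ?_, htan.self_of_nhds, ?_⟩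
  · -- a small ball around the origin contains a point where `Dρ` is positive
    obtain ⟨z, hz⟩ : ∃ z, 0 < fderiv ℝ ρ (X u) z := by
      obtain ⟨z, hz⟩ := DFunLike.ne_iff.1 hρ0
      rcases lt_or_gt_of_ne hz with h | h
      · exact ⟨-z, by rw [map_neg]; simpa using h⟩
      · exact ⟨z, by simpa using h⟩
    obtain ⟨t, ht, htK⟩ : ∃ t : ℝ, 0 < t ∧ t • z ∈ (K : Set W) := by
      have hc : Tendsto (fun t : ℝ => t • z) (𝓝[>] 0) (𝓝 0) := by
        have : Continuous fun t : ℝ => t • z := by fun_prop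
        simpa using (this.tendsto 0).mono_left nhdsWithin_le_nhds
      obtain ⟨t, h1, h2⟩ := ((hc.eventually hK.nhds_zero).and self_mem_nhdsWithin).exists
      exact ⟨t, h2, h1⟩
    have hXK : X u ∈ (K : Set W) := hclosed.frontier_subset hfr.self_of_nhds
    have hcone : t • z - X u ∈ posTangentConeAt (K : Set W) (X u) :=
      sub_mem_posTangentConeAt_of_segment_subset (K.convex.segment_subset hXK htK)
    have hmax : IsLocalMaxOn ρ (K : Set W) (X u) := by
      filter_upwards [self_mem_nhdsWithin, mem_nhdsWithin_of_mem_nhds (hU.mem_nhds hyU)]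
        with z' h1 h2
      rw [hρX.self_of_nhds]
      exact (hρK z' h2).1 h1
    have h1 := hmax.hasFDerivWithinAt_nonpos (hρd _ hyU).hasFDerivAt.hasFDerivWithinAt hcone
    rw [map_sub, map_smul, smul_eq_mul] at h1
    have := mul_pos ht hz
    linarith
  · intro v hv
    have hρ' : HasFDerivAt (fderiv ℝ ρ) (fderiv ℝ (fderiv ℝ ρ) (X u)) (X u) :=
      ((hρs _ hyU).fderiv_right (m := 1) (by norm_num; exact ENat.LEInfty.out)
        |>.differentiableAt (by norm_num)).hasFDerivAt
    have hX' : HasFDerivAt (fderiv ℝ X) (fderiv ℝ (fderiv ℝ X) u) u :=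
      ((hX.fderiv_right (m := 1) (by norm_num)).differentiableAt (by norm_num)).hasFDerivAt
    have key := fderiv_pairing (u := u) (L := fun u' => fderiv ℝ ρ (X u'))
      (Z := fun u' => fderiv ℝ X u' v) (c := fun _ => 0)
      (hρ'.comp u hXd.self_of_nhds.hasFDerivAt)
      (hX'.clm_apply (hasFDerivAt_const v u)) (hasFDerivAt_const 0 u)
      (htan.mono fun _ h => h v) v
    have hpos := hρ2 (fderiv ℝ X u v)
      (fun h => hv (hinj (by rw [h, map_zero]))) (htan.self_of_nhds v)
    simp at key
    linarith

variable [FiniteDimensional ℝ V] [FiniteDimensional ℝ W]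

/-- A supporting hyperplane is the tangent space and misses the interior point `0`, so the position
vector is transversal. -/
theorem frame_isInvertible (hK : SmoothPosCurved K)
    (hdim : Module.finrank ℝ W = Module.finrank ℝ V + 1)
    {X : V → W} {u : V} (hX : ContDiffAt ℝ 2 X u)
    (hinj : Function.Injective (fderiv ℝ X u))
    (hfr : ∀ᶠ u' in 𝓝 u, X u' ∈ frontier (K : Set W)) :
    (frame X u).IsInvertible := by
  obtain ⟨l, hl1, hl2, -⟩ := hK.exists_supporting hX hinj hfr
  refine CentroAffine.frame_isInvertible hdim fun v t h => ?_
  have ht : t = 0 := by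
    have := congrArg l h
    simpa [hl2, hl1.ne'] using this
  refine ⟨hinj ?_, ht⟩
  simpa [ht] using h

theorem metric_pos (hK : SmoothPosCurved K)
    (hdim : Module.finrank ℝ W = Module.finrank ℝ V + 1)
    {X : V → W} {u : V} (hX : ContDiffAt ℝ 2 X u)
    (hinj : Function.Injective (fderiv ℝ X u))
    (hfr : ∀ᶠ u' in 𝓝 u, X u' ∈ frontier (K : Set W)) {v : V} (hv : v ≠ 0) :
    0 < metric X u v v := by
  obtain ⟨l, hl1, hl2, hl3⟩ := hK.exists_supporting hX hinj hfr
  have hcon : conormal X u = (l (X u))⁻¹ • l :=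
    conormal_eq_of_apply (hK.frame_isInvertible hdim hX hinj hfr) (fun v => by simp [hl2])
      (by simp [hl1.ne'])
  rw [metric_apply, hcon]
  simp only [_root_.smul_apply, smul_eq_mul]
  have := mul_pos (inv_pos.2 hl1) (neg_pos.2 (hl3 v hv))
  linarith

end SmoothPosCurved

end ConvexBody

section Radial

variable {V W : Type*} [NormedAddCommGroup V] [NormedSpace ℝ V]
  [NormedAddCommGroup W] [NormedSpace ℝ W]

theorem hasFDerivAt_smul_chart {X : V → W} {u : V} (hX : DifferentiableAt ℝ X u) (t : ℝ) :
    HasFDerivAt (fun z : V × ℝ => z.2 • X z.1)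
      ((t • fderiv ℝ X u).coprod (ContinuousLinearMap.toSpanSingleton ℝ (X u))) (u, t) := by
  have h1 : HasFDerivAt (fun z : V × ℝ => X z.1)
      ((fderiv ℝ X u).comp (ContinuousLinearMap.fst ℝ V ℝ)) (u, t) :=
    HasFDerivAt.comp (u, t) (g := X) hX.hasFDerivAt hasFDerivAt_fst
  refine HasFDerivAt.congr_fderiv
    (HasFDerivAt.smul (hasFDerivAt_snd (𝕜 := ℝ) (p := (u, t))) h1) ?_
  ext <;> simp

/-- Polar coordinates `y = t • X(v)` near a point of the hypersurface, obtained from the inverse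
function theorem. -/
theorem exists_polar_inverse [CompleteSpace V] {X : V → W} {u : V} {T : Set V} (hT : T ∈ 𝓝 u)
    (hX : ContDiffAt ℝ ∞ X u) (hfr : (frame X u).IsInvertible) :
    ∃ g : W → V × ℝ, ContDiffAt ℝ ∞ g (X u) ∧ g (X u) = (u, 1) ∧
      ∀ᶠ y in 𝓝 (X u), (g y).1 ∈ T ∧ 0 < (g y).2 ∧ (g y).2 • X (g y).1 = y := by
  obtain ⟨e, he⟩ := hfr
  set Θ : V × ℝ → W := fun z => z.2 • X z.1 with hΘ
  have hΘs : ContDiffAt ℝ ∞ Θ (u, 1) :=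
    contDiffAt_snd.smul (ContDiffAt.comp (u, (1 : ℝ)) (g := X) hX contDiffAt_fst)
  have hΘ' : HasFDerivAt Θ (e : V × ℝ →L[ℝ] W) (u, 1) := by
    rw [he]
    simpa [frame] using hasFDerivAt_smul_chart (hX.differentiableAt (by simp)) 1
  have hΘ1 : Θ (u, 1) = X u := by simp [hΘ]
  refine ⟨hΘs.localInverse hΘ' (by simp), ?_, ?_, ?_⟩
  · rw [← hΘ1]; exact hΘs.to_localInverse hΘ' (by simp)
  · rw [← hΘ1]; exact hΘs.localInverse_apply_image hΘ' (by simp)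
  · have hc : ContinuousAt (hΘs.localInverse hΘ' (by simp)) (X u) := by
      rw [← hΘ1]; exact (hΘs.to_localInverse hΘ' (by simp)).continuousAt
    have hval : hΘs.localInverse hΘ' (by simp) (X u) = (u, 1) := by
      rw [← hΘ1]; exact hΘs.localInverse_apply_image hΘ' (by simp)
    have hnear : T ×ˢ Set.Ioi (0 : ℝ) ∈ 𝓝 (hΘs.localInverse hΘ' (by simp) (X u)) := by
      rw [hval]; exact prod_mem_nhds hT (Ioi_mem_nhds one_pos)
    have hr : ∀ᶠ y in 𝓝 (X u), Θ (hΘs.localInverse hΘ' (by simp) y) = y := by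
      rw [← hΘ1]; exact (hΘs.hasStrictFDerivAt' hΘ' (by simp)).eventually_right_inverse
    filter_upwards [hc.eventually hnear, hr] with y h1 h2
    exact ⟨h1.1, h1.2, h2⟩

end Radial

/-! ### The radial extension of a function on the hypersurface -/

theorem IsHomogeneous.contDiffAt_smul {W V' : Type*} [NormedAddCommGroup W] [NormedSpace ℝ W]
    [NormedAddCommGroup V'] [NormedSpace ℝ V'] {k : ℤ} {g : W → V'} {n : WithTop ℕ∞}
    (hg : IsHomogeneous k g) {t : ℝ} (ht : 0 < t) {y : W} (h : ContDiffAt ℝ n g y) :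
    ContDiffAt ℝ n g (t • y) := by
  have he : g = fun z => t ^ k • g (t⁻¹ • z) := by
    funext z
    rw [← hg t ht, smul_inv_smul₀ ht.ne']
  have hs : ContDiffAt ℝ n (fun z : W => t⁻¹ • z) (t • y) := contDiffAt_const.smul contDiffAt_id
  have h' : ContDiffAt ℝ n g (t⁻¹ • t • y) := by rwa [inv_smul_smul₀ ht.ne']
  rw [he]
  exact contDiffAt_const.smul (h'.comp (t • y) hs)

section Parametrization

variable {m : ℕ} {K : ConvexBody (EuclideanSpace ℝ (Fin (m + 1)))}
  {M : Type*} [TopologicalSpace M] [ChartedSpace (EuclideanSpace ℝ (Fin m)) M]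
  {x : M → EuclideanSpace ℝ (Fin (m + 1))}

theorem contDiffAt_inChart [IsManifold (𝓡 m) ∞ M] {W : Type*} [NormedAddCommGroup W]
    [NormedSpace ℝ W] {n : WithTop ℕ∞} (hn : n ≤ ∞) {F : M → W}
    (hF : ContMDiff (𝓡 m) 𝓘(ℝ, W) n F) (p : M) {u : EuclideanSpace ℝ (Fin m)}
    (hu : u ∈ (extChartAt (𝓡 m) p).target) : ContDiffAt ℝ n (inChart F p) u := by
  have h1 : ContMDiffOn 𝓘(ℝ, EuclideanSpace ℝ (Fin m)) 𝓘(ℝ, W) n (inChart F p)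
      (extChartAt (𝓡 m) p).target :=
    hF.comp_contMDiffOn ((contMDiffOn_extChartAt_symm (n := ∞) p).of_le hn)
  exact (contMDiffOn_iff_contDiffOn.1 h1).contDiffAt ((isOpen_extChartAt_target p).mem_nhds hu)

theorem inChart_apply_extChartAt {β : Type*} (F : M → β) (p : M) :
    inChart F p (extChartAt (𝓡 m) p p) = F p := by
  simp [inChart]

namespace Parametrizes

variable (hx : Parametrizes x K)
include hx

theorem inChart_mem_frontier (p : M) (u : EuclideanSpace ℝ (Fin m)) :
    inChart x p u ∈ frontier (K : Set (EuclideanSpace ℝ (Fin (m + 1)))) := by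
  rw [← hx.range_eq]; exact Set.mem_range_self _

variable [IsManifold (𝓡 m) ∞ M]

theorem fderiv_inChart_injective (p : M) {u : EuclideanSpace ℝ (Fin m)}
    (hu : u ∈ (extChartAt (𝓡 m) p).target) :
    Function.Injective (fderiv ℝ (inChart x p) u) := by
  have : IsManifold (𝓡 m) 1 M := IsManifold.of_le (n := ∞) (by simp)
  have h1 := isInvertible_mfderivWithin_extChartAt_symm (I := 𝓡 m) hu
  have hrange : Set.range (𝓡 m) = Set.univ := by simp
  rw [hrange, mfderivWithin_univ] at h1
  have hs : MDifferentiableAt 𝓘(ℝ, EuclideanSpace ℝ (Fin m)) (𝓡 m)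
      (extChartAt (𝓡 m) p).symm u := by
    have := mdifferentiableWithinAt_extChartAt_symm (I := 𝓡 m) hu
    rwa [hrange, mdifferentiableWithinAt_univ] at this
  have hxd : MDifferentiableAt (𝓡 m) 𝓘(ℝ, EuclideanSpace ℝ (Fin (m + 1))) x
      ((extChartAt (𝓡 m) p).symm u) := hx.smooth.mdifferentiable (by simp) _
  rw [← mfderiv_eq_fderiv, inChart, mfderiv_comp u hxd hs]
  exact (hx.immersion _).comp h1.injective

theorem isLevelChart (hK : SmoothPosCurved K) (p : M) {u : EuclideanSpace ℝ (Fin m)}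
    (hu : u ∈ (extChartAt (𝓡 m) p).target) :
    IsLevelChart (gauge (K : Set (EuclideanSpace ℝ (Fin (m + 1))))) (inChart x p) u := by
  have hs : ∀ u ∈ (extChartAt (𝓡 m) p).target, ContDiffAt ℝ 2 (inChart x p) u := fun u hu =>
    (contDiffAt_inChart le_rfl hx.smooth p hu).of_le ENat.LEInfty.out
  refine ⟨hs u hu, ?_, ?_⟩
  · filter_upwards [(isOpen_extChartAt_target p).mem_nhds hu] with u' hu'
    exact hK.frame_isInvertible (by simp) (hs u' hu') (hx.fderiv_inChart_injective p hu')
      (Eventually.of_forall (hx.inChart_mem_frontier p))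
  · exact Eventually.of_forall fun u' => hK.gauge_eq_one_iff.2 (hx.inChart_mem_frontier p u')

end Parametrizes

/-- The point `p` of `M` such that `y ≠ 0` lies on the ray through `x p`. At `y = 0` the value is
irrelevant. -/
noncomputable def footpoint [Nonempty M] (x : M → EuclideanSpace ℝ (Fin (m + 1)))
    (K : ConvexBody (EuclideanSpace ℝ (Fin (m + 1)))) (y : EuclideanSpace ℝ (Fin (m + 1))) : M :=
  Function.invFun x ((gauge (K : Set (EuclideanSpace ℝ (Fin (m + 1)))) y)⁻¹ • y)

namespace Parametrizes

variable [Nonempty M] (hx : Parametrizes x K) (hK : SmoothPosCurved K)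

omit [ChartedSpace (EuclideanSpace ℝ (Fin m)) M] [TopologicalSpace M] in
theorem footpoint_smul (x : M → EuclideanSpace ℝ (Fin (m + 1))) {t : ℝ} (ht : 0 < t)
    (y : EuclideanSpace ℝ (Fin (m + 1))) : footpoint x K (t • y) = footpoint x K y := by
  rw [footpoint, footpoint, gauge_smul_of_nonneg ht.le, smul_eq_mul, mul_inv, smul_smul]
  congr 2
  field_simp

omit [ChartedSpace (EuclideanSpace ℝ (Fin m)) M] [TopologicalSpace M] in
theorem comp_footpoint_isHomogeneous (x : M → EuclideanSpace ℝ (Fin (m + 1)))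
    (K : ConvexBody (EuclideanSpace ℝ (Fin (m + 1)))) (f : M → ℝ) :
    IsHomogeneous 0 fun y => f (footpoint x K y) := fun t ht y => by
  simp only [footpoint_smul x ht y, zpow_zero, one_smul]

include hx hK

omit [Nonempty M] in
theorem gauge_apply (p : M) : gauge (K : Set (EuclideanSpace ℝ (Fin (m + 1)))) (x p) = 1 :=
  hK.gauge_eq_one_iff.2 (hx.range_eq ▸ Set.mem_range_self p)

omit [Nonempty M] in
theorem ne_zero (p : M) : x p ≠ 0 := by
  intro h
  have := hx.gauge_apply hK p
  rw [h, gauge_zero] at this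
  exact zero_ne_one this

theorem footpoint_apply (p : M) : footpoint x K (x p) = p := by
  rw [footpoint, hx.gauge_apply hK, inv_one, one_smul]
  exact Function.leftInverse_invFun hx.injective p

theorem apply_footpoint {y : EuclideanSpace ℝ (Fin (m + 1))} (hy : y ≠ 0) :
    gauge (K : Set (EuclideanSpace ℝ (Fin (m + 1)))) y • x (footpoint x K y) = y := by
  have hg := hK.gauge_pos hy
  have h1 : (gauge (K : Set (EuclideanSpace ℝ (Fin (m + 1)))) y)⁻¹ • y ∈ Set.range x := by
    rw [hx.range_eq, ← hK.gauge_eq_one_iff, gauge_smul_of_nonneg (inv_nonneg.2 hg.le),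
      smul_eq_mul, inv_mul_cancel₀ hg.ne']
  rw [footpoint, Function.invFun_eq h1, smul_inv_smul₀ hg.ne']

omit [Nonempty M] in
theorem gauge_smul_apply {t : ℝ} (ht : 0 < t) (p : M) :
    gauge (K : Set (EuclideanSpace ℝ (Fin (m + 1)))) (t • x p) = t := by
  rw [gauge_smul_of_nonneg ht.le, hx.gauge_apply hK, smul_eq_mul, mul_one]

theorem footpoint_smul_apply {t : ℝ} (ht : 0 < t) (p : M) : footpoint x K (t • x p) = p := by
  rw [footpoint_smul x ht, hx.footpoint_apply hK]

variable [IsManifold (𝓡 m) ∞ M]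

/-- Near `x p`, the gauge and the footpoint are the polar coordinates. -/
theorem exists_local_polar (p : M) :
    ∃ g : EuclideanSpace ℝ (Fin (m + 1)) → EuclideanSpace ℝ (Fin m) × ℝ,
      ContDiffAt ℝ ∞ g (x p) ∧ g (x p) = (extChartAt (𝓡 m) p p, 1) ∧
      (gauge (K : Set (EuclideanSpace ℝ (Fin (m + 1)))) =ᶠ[𝓝 (x p)] fun y => (g y).2) ∧
      footpoint x K =ᶠ[𝓝 (x p)] fun y => (extChartAt (𝓡 m) p).symm (g y).1 := by
  have hu : extChartAt (𝓡 m) p p ∈ (extChartAt (𝓡 m) p).target := mem_extChartAt_target p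
  obtain ⟨g, h1, h2, h3⟩ := exists_polar_inverse
    ((isOpen_extChartAt_target (I := 𝓡 m) p).mem_nhds hu)
    (contDiffAt_inChart le_rfl hx.smooth p hu) (hx.isLevelChart hK p hu).frame_isInvertible
  rw [inChart_apply_extChartAt] at h1 h2 h3
  refine ⟨g, h1, h2, ?_, ?_⟩
  · filter_upwards [h3] with y ⟨_, hy2, hy3⟩
    conv_lhs => rw [← hy3]
    exact hx.gauge_smul_apply hK hy2 _
  · filter_upwards [h3] with y ⟨_, hy2, hy3⟩
    conv_lhs => rw [← hy3]
    exact hx.footpoint_smul_apply hK hy2 _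

theorem contDiffAt_gauge {y : EuclideanSpace ℝ (Fin (m + 1))} (hy : y ≠ 0) :
    ContDiffAt ℝ ∞ (gauge (K : Set (EuclideanSpace ℝ (Fin (m + 1))))) y := by
  have h1 : ∀ p, ContDiffAt ℝ ∞ (gauge (K : Set (EuclideanSpace ℝ (Fin (m + 1))))) (x p) := by
    intro p
    obtain ⟨g, hg, -, h, -⟩ := hx.exists_local_polar hK p
    exact (contDiffAt_snd.comp _ hg).congr_of_eventuallyEq h
  rw [← hx.apply_footpoint hK hy]
  exact (SmoothPosCurved.gauge_isHomogeneous K).contDiffAt_smul (hK.gauge_pos hy) (h1 _)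

theorem continuousAt_footpoint {y : EuclideanSpace ℝ (Fin (m + 1))} (hy : y ≠ 0) :
    ContinuousAt (footpoint x K) y := by
  have h1 : ∀ p, ContinuousAt (footpoint x K) (x p) := by
    intro p
    obtain ⟨g, hg, hgp, -, h⟩ := hx.exists_local_polar hK p
    refine ContinuousAt.congr ?_ h.symm
    refine ContinuousAt.comp (g := (extChartAt (𝓡 m) p).symm) ?_ hg.continuousAt.fst
    rw [hgp]
    exact continuousAt_extChartAt_symm p
  have ht := hK.gauge_pos hy
  set t := gauge (K : Set (EuclideanSpace ℝ (Fin (m + 1)))) y with ht'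
  have he : footpoint x K = fun z => footpoint x K (t⁻¹ • z) :=
    funext fun z => (footpoint_smul x (inv_pos.2 ht) z).symm
  rw [he]
  refine ContinuousAt.comp (f := fun z => t⁻¹ • z) (g := footpoint x K) ?_
    (continuous_const_smul t⁻¹).continuousAt
  have : t⁻¹ • y = x (footpoint x K y) := by
    conv_lhs => rw [← hx.apply_footpoint hK hy, inv_smul_smul₀ ht.ne']
  rw [this]
  exact h1 _

theorem contDiffAt_comp_footpoint {f : M → ℝ} (hf : ContMDiff (𝓡 m) 𝓘(ℝ, ℝ) 2 f)
    {y : EuclideanSpace ℝ (Fin (m + 1))} (hy : y ≠ 0) :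
    ContDiffAt ℝ 2 (fun y => f (footpoint x K y)) y := by
  have h1 : ∀ p, ContDiffAt ℝ 2 (fun y => f (footpoint x K y)) (x p) := by
    intro p
    obtain ⟨g, hg, hgp, -, h⟩ := hx.exists_local_polar hK p
    have hfu : ContDiffAt ℝ 2 (inChart f p) (g (x p)).1 := by
      rw [hgp]
      exact contDiffAt_inChart ENat.LEInfty.out hf p (mem_extChartAt_target p)
    have hg1 : ContDiffAt ℝ 2 (fun y => (g y).1) (x p) :=
      (contDiffAt_fst.comp _ hg).of_le ENat.LEInfty.out
    refine (ContDiffAt.comp (x p) hfu hg1).congr_of_eventuallyEq ?_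
    filter_upwards [h] with z hz
    rw [hz]; rfl
  rw [← hx.apply_footpoint hK hy]
  exact (comp_footpoint_isHomogeneous x K f).contDiffAt_smul (hK.gauge_pos hy) (h1 _)

/-- Positivity of the Hessian of the gauge on tangent vectors at any `y ≠ 0`: by homogeneity it is
enough to know it on the boundary, where it is the positivity of the centro-affine metric. -/
theorem hess_gauge_pos {y : EuclideanSpace ℝ (Fin (m + 1))} (hy : y ≠ 0)
    {w : EuclideanSpace ℝ (Fin (m + 1))} (hw : w ≠ 0)
    (hyw : fderiv ℝ (gauge (K : Set (EuclideanSpace ℝ (Fin (m + 1))))) y w = 0) :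
    0 < fderiv ℝ (fderiv ℝ (gauge (K : Set (EuclideanSpace ℝ (Fin (m + 1)))))) y w w := by
  have hhom := SmoothPosCurved.gauge_isHomogeneous K
  set N := gauge (K : Set (EuclideanSpace ℝ (Fin (m + 1)))) with hN
  have h1 : ∀ p, fderiv ℝ N (x p) w = 0 → 0 < fderiv ℝ (fderiv ℝ N) (x p) w w := by
    intro p hpw
    have hu : extChartAt (𝓡 m) p p ∈ (extChartAt (𝓡 m) p).target := mem_extChartAt_target p
    have hL := hx.isLevelChart hK p hu
    rw [← hN] at hL
    have hxp : inChart x p (extChartAt (𝓡 m) p p) = x p := inChart_apply_extChartAt x p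
    set X := inChart (m := m) x p
    set u := extChartAt (𝓡 m) p p
    have hNs : ContDiffAt ℝ 2 N (X u) :=
      (hx.contDiffAt_gauge hK hL.ne_zero).of_le ENat.LEInfty.out
    have hE : fderiv ℝ N (X u) (X u) = 1 := by
      rw [hhom.fderiv_apply_self (hNs.differentiableAt (by norm_num)), hL.level.self_of_nhds]
      simp
    rw [← hxp] at hpw ⊢
    have hcon := conormal_eq_fderiv_level hL.differentiableAt
      (hNs.differentiableAt (by norm_num)) hL.level hL.frame_isInvertible hE
    have hwd : w = fderiv ℝ X u (tangentPart X u w) := by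
      conv_lhs => rw [frame_decomp hL.frame_isInvertible w, hcon, hpw, zero_smul, add_zero]
    have hv : tangentPart X u w ≠ 0 := fun h => hw (by rw [hwd, h, map_zero])
    rw [hwd, ← metric_eq_of_level hL.contDiffAt hNs hL.level hL.frame_isInvertible hE]
    exact hK.metric_pos (by simp) hL.contDiffAt (hx.fderiv_inChart_injective p hu)
      (Eventually.of_forall (hx.inChart_mem_frontier p)) hv
  have ht := hK.gauge_pos hy
  have hy' := hx.apply_footpoint hK hy
  set q := footpoint x K y
  set t := gauge (K : Set (EuclideanSpace ℝ (Fin (m + 1)))) y with ht'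
  rw [← hy', hhom.fderiv t ht] at hyw
  rw [← hy', hhom.fderiv.fderiv t ht]
  have := h1 q (by simpa using hyw)
  simp only [_root_.smul_apply, smul_eq_mul]
  positivity

/-- The gradient field on `E` of the `0`-homogeneous extension of `f`. -/
theorem isGaugeGradient {f : M → ℝ} (hf : ContMDiff (𝓡 m) 𝓘(ℝ, ℝ) 2 f) :
    IsGaugeGradient (gauge (K : Set (EuclideanSpace ℝ (Fin (m + 1)))))
      (fun y => f (footpoint x K y))
      (gaugeGradient (gauge (K : Set (EuclideanSpace ℝ (Fin (m + 1)))))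
        (fun y => f (footpoint x K y))) :=
  gaugeGradient_isGaugeGradient (SmoothPosCurved.gauge_isHomogeneous K)
    (comp_footpoint_isHomogeneous x K f)
    (fun _ hy => hx.contDiffAt_gauge hK hy) (fun _ hy => hx.contDiffAt_comp_footpoint hK hf hy)
    (fun _ hy => hK.gauge_pos hy) (fun _ hy _ hw h => hx.hess_gauge_pos hK hy hw h)

omit [IsManifold (𝓡 m) ∞ M] in
theorem inChart_eq_comp (f : M → ℝ) (p : M) :
    inChart (m := m) f p = (fun y => f (footpoint x K y)) ∘ inChart x p := by
  funext u
  simp only [inChart, Function.comp_apply, hx.footpoint_apply hK]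

variable {f : M → ℝ} (hf : ContMDiff (𝓡 m) 𝓘(ℝ, ℝ) 2 f) (p : M)
include hf

/-- The centro-affine Laplacian is the flat divergence of the gauge gradient. -/
theorem lap_eq : lap x f p = LinearMap.trace ℝ (EuclideanSpace ℝ (Fin (m + 1)))
    (fderiv ℝ (gaugeGradient (gauge (K : Set (EuclideanSpace ℝ (Fin (m + 1)))))
      (fun y => f (footpoint x K y))) (x p)).toLinearMap := by
  have h := (hx.isGaugeGradient hK hf).laplacian_eq
    (hx.isLevelChart hK p (mem_extChartAt_target (I := 𝓡 m) p))
  rw [lap, hx.inChart_eq_comp hK f p, h, inChart_apply_extChartAt]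

theorem gradSq_eq : gradSq x f p =
    fderiv ℝ (fderiv ℝ (gauge (K : Set (EuclideanSpace ℝ (Fin (m + 1)))))) (x p)
      (gaugeGradient (gauge (K : Set (EuclideanSpace ℝ (Fin (m + 1)))))
        (fun y => f (footpoint x K y)) (x p))
      (gaugeGradient (gauge (K : Set (EuclideanSpace ℝ (Fin (m + 1)))))
        (fun y => f (footpoint x K y)) (x p)) := by
  have h := (hx.isGaugeGradient hK hf).gradNormSq_eq
    (hx.isLevelChart hK p (mem_extChartAt_target (I := 𝓡 m) p))
  rw [gradSq, hx.inChart_eq_comp hK f p, h, inChart_apply_extChartAt]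

theorem hessStarNormSq_eq : hessStarNormSq x f p =
    LinearMap.trace ℝ (EuclideanSpace ℝ (Fin (m + 1)))
      ((fderiv ℝ (gaugeGradient (gauge (K : Set (EuclideanSpace ℝ (Fin (m + 1)))))
        (fun y => f (footpoint x K y))) (x p)).comp
      (fderiv ℝ (gaugeGradient (gauge (K : Set (EuclideanSpace ℝ (Fin (m + 1)))))
        (fun y => f (footpoint x K y))) (x p))).toLinearMap - 2 * gradSq x f p := by
  have h := (hx.isGaugeGradient hK hf).tensorNormSq_hessStar_eq
    (hx.isLevelChart hK p (mem_extChartAt_target (I := 𝓡 m) p)) (by simp)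
  rw [hx.gradSq_eq hK hf, hessStarNormSq, hx.inChart_eq_comp hK f p, h, inChart_apply_extChartAt]

end Parametrizes
end Parametrization

/-! ### The Jacobian of polar coordinates -/

section PolarJacobian

/-- Splitting off the last coordinate. -/
noncomputable def snocCLE (m : ℕ) :
    EuclideanSpace ℝ (Fin (m + 1)) ≃L[ℝ] EuclideanSpace ℝ (Fin m) × ℝ :=
  LinearEquiv.toContinuousLinearEquiv
    { toFun := fun y => (WithLp.toLp 2 fun i => y (Fin.castSucc i), y (Fin.last m))
      invFun := fun z => WithLp.toLp 2 (Fin.snoc (α := fun _ => ℝ) z.1 z.2)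
      map_add' := fun y z => by ext <;> simp
      map_smul' := fun c y => by ext <;> simp
      left_inv := fun y => by
        ext i
        refine Fin.lastCases ?_ (fun i => ?_) i <;> simp
      right_inv := fun z => by ext <;> simp }

theorem snocCLE_apply (m : ℕ) (y : EuclideanSpace ℝ (Fin (m + 1))) :
    snocCLE m y = (WithLp.toLp 2 fun i => y (Fin.castSucc i), y (Fin.last m)) := rfl

theorem measurePreserving_snocCLE (m : ℕ) : MeasurePreserving (snocCLE m) := by
  have h1 := PiLp.volume_preserving_ofLp (Fin (m + 1))
  have h2 := volume_preserving_piFinSuccAbove (fun _ : Fin (m + 1) => ℝ) (Fin.last m)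
  have h3 : MeasurePreserving (Prod.swap : ℝ × (Fin m → ℝ) → (Fin m → ℝ) × ℝ) :=
    Measure.measurePreserving_swap
  have h4 := (PiLp.volume_preserving_toLp (Fin m)).prod (MeasurePreserving.id (volume : Measure ℝ))
  have h := h4.comp (h3.comp (h2.comp h1))
  convert h using 1
  · funext y
    simp [snocCLE_apply, MeasurableEquiv.piFinSuccAbove, Fin.insertNthEquiv]
    rfl
  · exact Measure.volume_eq_prod _ _

theorem volDensity_nonneg {m : ℕ} (X : EuclideanSpace ℝ (Fin m) → EuclideanSpace ℝ (Fin (m + 1)))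
    (u : EuclideanSpace ℝ (Fin m)) : 0 ≤ volDensity X u := abs_nonneg _

/-- The Jacobian of polar coordinates. -/
theorem abs_det_polar {m : ℕ} (X : EuclideanSpace ℝ (Fin m) → EuclideanSpace ℝ (Fin (m + 1)))
    (u : EuclideanSpace ℝ (Fin m)) {t : ℝ} (ht : 0 < t) :
    |((((t • fderiv ℝ X u).coprod (ContinuousLinearMap.toSpanSingleton ℝ (X u))).comp
      (snocCLE m : EuclideanSpace ℝ (Fin (m + 1)) →L[ℝ] EuclideanSpace ℝ (Fin m) × ℝ)).det)| =
      volDensity X u * t ^ m := by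
  set A := (((t • fderiv ℝ X u).coprod (ContinuousLinearMap.toSpanSingleton ℝ (X u))).comp
      (snocCLE m : EuclideanSpace ℝ (Fin (m + 1)) →L[ℝ] EuclideanSpace ℝ (Fin m) × ℝ)) with hA
  set b := (EuclideanSpace.basisFun (Fin (m + 1)) ℝ).toBasis with hb
  have h1 := b.det_comp A.toLinearMap b
  rw [b.det_self, mul_one] at h1
  have h2 : (A.toLinearMap ∘ b : Fin (m + 1) → EuclideanSpace ℝ (Fin (m + 1))) =
      fun i => (Fin.snoc (α := fun _ => ℝ) (fun _ : Fin m => t) 1 : Fin (m + 1) → ℝ) i •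
        (Fin.snoc (α := fun _ => EuclideanSpace ℝ (Fin (m + 1)))
          (fun i : Fin m => fderiv ℝ X u (EuclideanSpace.basisFun (Fin m) ℝ i)) (X u)) i := by
    funext i
    refine Fin.lastCases ?_ (fun i => ?_) i
    · have : snocCLE m (b (Fin.last m)) = (0, 1) := by
        rw [snocCLE_apply, hb]
        ext j <;> simp [Fin.castSucc_ne_last]
      simp [hA, this]
    · have : snocCLE m (b (Fin.castSucc i)) = (EuclideanSpace.basisFun (Fin m) ℝ i, 0) := by
        rw [snocCLE_apply, hb]
        ext j
        · simp
        · simp [(Fin.castSucc_ne_last i).symm]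
      simp [hA, this]
  have h3 : A.det = LinearMap.det A.toLinearMap := rfl
  rw [h3, ← h1, h2, AlternatingMap.map_smul_univ, volDensity, smul_eq_mul, abs_mul, mul_comm]
  congr 1
  rw [Fin.prod_univ_castSucc]
  simp [abs_of_pos ht]

/-- The volume of a cone over a piece of a hypersurface. -/
theorem volume_polar_image {m : ℕ}
    {X : EuclideanSpace ℝ (Fin m) → EuclideanSpace ℝ (Fin (m + 1))}
    {B : Set (EuclideanSpace ℝ (Fin m))} {J : Set ℝ} (hB : MeasurableSet B) (hJ : MeasurableSet J)
    (hX : ∀ u ∈ B, DifferentiableAt ℝ X u) (hJ0 : J ⊆ Set.Ioi 0)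
    (hinj : Set.InjOn (fun z : EuclideanSpace ℝ (Fin m) × ℝ => z.2 • X z.1) (B ×ˢ J))
    (hmeas : AEMeasurable (fun u => ENNReal.ofReal (volDensity X u)) (volume.restrict B)) :
    volume ((fun z : EuclideanSpace ℝ (Fin m) × ℝ => z.2 • X z.1) '' (B ×ˢ J)) =
      (∫⁻ u in B, ENNReal.ofReal (volDensity X u)) * ∫⁻ t in J, ENNReal.ofReal (t ^ m) := by
  set Θ : EuclideanSpace ℝ (Fin m) × ℝ → EuclideanSpace ℝ (Fin (m + 1)) :=
    fun z => z.2 • X z.1 with hΘ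
  set e := snocCLE m with he
  have hS : MeasurableSet (B ×ˢ J) := hB.prod hJ
  have hs : MeasurableSet (e ⁻¹' (B ×ˢ J)) := e.continuous.measurable hS
  have hcv := lintegral_abs_det_fderiv_eq_addHaar_image volume (f := fun y => Θ (e y)) hs
    (f' := fun y => (((e y).2 • fderiv ℝ X (e y).1).coprod
      (ContinuousLinearMap.toSpanSingleton ℝ (X (e y).1))).comp
      (e : EuclideanSpace ℝ (Fin (m + 1)) →L[ℝ] EuclideanSpace ℝ (Fin m) × ℝ))
    (fun y hy => (HasFDerivAt.comp y (g := Θ)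
      (hasFDerivAt_smul_chart (hX _ hy.1) (e y).2) e.hasFDerivAt).hasFDerivWithinAt)
    (fun y hy z hz h => e.injective (hinj hy hz h))
  have himg : (fun y => Θ (e y)) '' (e ⁻¹' (B ×ˢ J)) = Θ '' (B ×ˢ J) := by
    rw [← Function.comp_def, Set.image_comp, Set.image_preimage_eq _ e.surjective]
  rw [himg] at hcv
  rw [← hcv]
  have h1 : ∀ y ∈ e ⁻¹' (B ×ˢ J), ENNReal.ofReal |((((e y).2 • fderiv ℝ X (e y).1).coprod
      (ContinuousLinearMap.toSpanSingleton ℝ (X (e y).1))).comp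
      (e : EuclideanSpace ℝ (Fin (m + 1)) →L[ℝ] EuclideanSpace ℝ (Fin m) × ℝ)).det| =
      ENNReal.ofReal (volDensity X (e y).1) * ENNReal.ofReal ((e y).2 ^ m) := by
    intro y hy
    rw [abs_det_polar X _ (hJ0 hy.2), ENNReal.ofReal_mul (volDensity_nonneg _ _)]
  rw [setLIntegral_congr_fun hs h1,
    (measurePreserving_snocCLE m).setLIntegral_comp_preimage_emb
      e.toHomeomorph.measurableEmbedding
      (fun z => ENNReal.ofReal (volDensity X z.1) * ENNReal.ofReal (z.2 ^ m)) (B ×ˢ J),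
    Measure.volume_eq_prod, ← Measure.prod_restrict]
  exact lintegral_prod_mul hmeas
    (ENNReal.measurable_ofReal.comp (measurable_id.pow_const m)).aemeasurable

end PolarJacobian

/-! ### Lebesgue measure in polar coordinates -/

section PolarMeasure

theorem measurableSet_inter_preimage {α β : Type*} [TopologicalSpace α] [MeasurableSpace α]
    [OpensMeasurableSpace α] [TopologicalSpace β] [MeasurableSpace β] [BorelSpace β] {g : α → β}
    {s : Set α} (hg : ContinuousOn g s) (hs : MeasurableSet s) {A : Set β} (hA : MeasurableSet A) :
    MeasurableSet (s ∩ g ⁻¹' A) := by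
  have h1 : MeasurableSet (s.domRestrict g ⁻¹' A) :=
    (continuousOn_iff_continuous_domRestrict.1 hg).measurable hA
  have h2 : s ∩ g ⁻¹' A = Subtype.val '' (s.domRestrict g ⁻¹' A) := by
    rw [Set.domRestrict_eq, Set.preimage_comp, Subtype.image_preimage_coe]
  rw [h2]
  exact hs.subtype_image h1

variable {m : ℕ} {K : ConvexBody (EuclideanSpace ℝ (Fin (m + 1)))}
  {M : Type*} [TopologicalSpace M] [ChartedSpace (EuclideanSpace ℝ (Fin m)) M]
  {x : M → EuclideanSpace ℝ (Fin (m + 1))}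

/-- The radial part `t^m dt` of Lebesgue measure in polar coordinates. -/
noncomputable def radialMeasure (m : ℕ) : Measure ℝ :=
  (volume.restrict (Set.Ioi 0)).withDensity fun t => ENNReal.ofReal (t ^ m)

instance (m : ℕ) : SigmaFinite (radialMeasure m) := by
  have : radialMeasure m =
      (volume.restrict (Set.Ioi 0)).withDensity fun t => ((t ^ m).toNNReal : ENNReal) := rfl
  rw [this]; infer_instance

theorem radialMeasure_apply (m : ℕ) {J : Set ℝ} (hJ : MeasurableSet J) :
    radialMeasure m J = ∫⁻ t in J ∩ Set.Ioi 0, ENNReal.ofReal (t ^ m) := by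
  rw [radialMeasure, withDensity_apply _ hJ, Measure.restrict_restrict hJ]

theorem radialMeasure_Iic_ne_zero (m : ℕ) : radialMeasure m (Set.Iic 1) ≠ 0 := by
  rw [radialMeasure_apply m measurableSet_Iic, Set.inter_comm, Set.Ioi_inter_Iic,
    ← pos_iff_ne_zero, setLIntegral_pos_iff (by fun_prop)]
  have h : (Function.support fun t : ℝ => ENNReal.ofReal (t ^ m)) ∩ Set.Ioc 0 1 =
      Set.Ioc 0 1 :=
    Set.inter_eq_right.2 fun t ht => (ENNReal.ofReal_pos.2 (pow_pos ht.1 m)).ne'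
  rw [h]
  simp

theorem radialMeasure_Iic_ne_top (m : ℕ) : radialMeasure m (Set.Iic 1) ≠ ⊤ := by
  rw [radialMeasure_apply m measurableSet_Iic]
  refine ((setLIntegral_mono' (g := fun _ => 1) (measurableSet_Iic.inter measurableSet_Ioi)
    ?_).trans_lt ?_).ne
  · rintro t ⟨h1, h2⟩
    rw [← ENNReal.ofReal_one]
    exact ENNReal.ofReal_le_ofReal (pow_le_one₀ (le_of_lt h2) h1)
  · rw [Set.inter_comm, Set.Ioi_inter_Iic]; simp

variable [MeasurableSpace M]

/-- The measure which the centro-affine volume form defines in the chart at `p`. -/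
noncomputable def chartMeasure (x : M → EuclideanSpace ℝ (Fin (m + 1))) (p : M) : Measure M :=
  Measure.map (extChartAt (𝓡 m) p).symm
    ((volume.restrict (extChartAt (𝓡 m) p).target).withDensity
      (fun u => ENNReal.ofReal (volDensity (inChart x p) u)))

/-- Lebesgue measure of `E ∖ {0}` in polar coordinates with respect to `K`. -/
noncomputable def polarMeasure [Nonempty M] (x : M → EuclideanSpace ℝ (Fin (m + 1)))
    (K : ConvexBody (EuclideanSpace ℝ (Fin (m + 1)))) : Measure (M × ℝ) :=
  Measure.map (fun y => (footpoint x K y, gauge (K : Set (EuclideanSpace ℝ (Fin (m + 1)))) y))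
    (volume.restrict {0}ᶜ)

namespace Parametrizes

variable [BorelSpace M] [IsManifold (𝓡 m) ∞ M] (hx : Parametrizes x K) (hK : SmoothPosCurved K)

omit [IsManifold (𝓡 m) ∞ M] in
theorem chartMeasure_apply (x : M → EuclideanSpace ℝ (Fin (m + 1))) (p : M) {A : Set M}
    (hA : MeasurableSet A) : chartMeasure x p A =
      ∫⁻ u in (extChartAt (𝓡 m) p).target ∩ (extChartAt (𝓡 m) p).symm ⁻¹' A,
        ENNReal.ofReal (volDensity (inChart x p) u) := by
  have hT : IsOpen (extChartAt (𝓡 m) p).target := isOpen_extChartAt_target p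
  have hc : AEMeasurable (extChartAt (𝓡 m) p).symm
      (volume.restrict (extChartAt (𝓡 m) p).target) :=
    (continuousOn_extChartAt_symm p).aemeasurable hT.measurableSet
  rw [chartMeasure, Measure.map_apply_of_aemeasurable
    (hc.mono_ac (withDensity_absolutelyContinuous _ _)) hA, withDensity_apply',
    Measure.restrict_restrict' hT.measurableSet, Set.inter_comm]

omit [IsManifold (𝓡 m) ∞ M] in
theorem chartMeasure_inter_source (x : M → EuclideanSpace ℝ (Fin (m + 1))) (p : M) {A : Set M}
    (hA : MeasurableSet A) :
    chartMeasure x p (A ∩ (extChartAt (𝓡 m) p).source) = chartMeasure x p A := by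
  have hS : MeasurableSet (extChartAt (𝓡 m) p).source :=
    (isOpen_extChartAt_source p).measurableSet
  rw [chartMeasure_apply x p (hA.inter hS), chartMeasure_apply x p hA]
  congr 2
  ext u
  simp only [Set.mem_inter_iff, Set.mem_preimage]
  exact ⟨fun h => ⟨h.1, h.2.1⟩, fun h => ⟨h.1, h.2, (extChartAt (𝓡 m) p).map_target h.1⟩⟩

include hx in
omit [MeasurableSpace M] [BorelSpace M] in
theorem continuousOn_volDensity (p : M) :
    ContinuousOn (volDensity (inChart x p)) (extChartAt (𝓡 m) p).target := by
  intro u hu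
  have hX := contDiffAt_inChart le_rfl hx.smooth p hu
  have hX' : ContinuousAt (fderiv ℝ (inChart x p)) u :=
    (hX.fderiv_right (m := 0) (by simp)).continuousAt
  have hproj : ∀ i, Continuous fun y : EuclideanSpace ℝ (Fin (m + 1)) => y i := fun i => by
    fun_prop
  refine ContinuousAt.continuousWithinAt ?_
  refine ContinuousAt.abs ?_
  simp only [Module.Basis.det_apply, Matrix.det_apply]
  refine tendsto_finsetSum _ fun σ _ => Tendsto.const_smul (tendsto_finsetProd _ fun i _ => ?_) _
  simp only [Module.Basis.toMatrix_apply]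
  refine Fin.lastCases ?_ (fun i => ?_) i
  · simpa [Function.comp_def] using
      (hproj (σ (Fin.last m))).continuousAt.tendsto.comp hX.continuousAt.tendsto
  · simpa [Function.comp_def] using (hproj (σ i.castSucc)).continuousAt.tendsto.comp
      (hX'.clm_apply (continuousAt_const (y := EuclideanSpace.basisFun (Fin m) ℝ i))).tendsto

variable [Nonempty M]
include hx hK

theorem aemeasurable_polar : AEMeasurable (fun y => (footpoint x K y,
    gauge (K : Set (EuclideanSpace ℝ (Fin (m + 1)))) y))
    (volume.restrict ({0}ᶜ : Set (EuclideanSpace ℝ (Fin (m + 1))))) := by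
  have h0 : MeasurableSet ({0}ᶜ : Set (EuclideanSpace ℝ (Fin (m + 1)))) :=
    (measurableSet_singleton _).compl
  refine AEMeasurable.prodMk (ContinuousOn.aemeasurable (fun y hy =>
    (hx.continuousAt_footpoint hK hy).continuousWithinAt) h0) ?_
  exact (continuous_gauge K.convex hK.nhds_zero).measurable.aemeasurable

/-- Over a chart domain, Lebesgue measure in polar coordinates is the product of the chart measure
and the radial measure. -/
theorem polarMeasure_prod (p : M) {A : Set M} (hA : MeasurableSet A)
    (hAp : A ⊆ (extChartAt (𝓡 m) p).source) {J : Set ℝ} (hJ : MeasurableSet J) :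
    polarMeasure x K (A ×ˢ J) = chartMeasure x p A * radialMeasure m J := by
  have h0 : MeasurableSet ({0}ᶜ : Set (EuclideanSpace ℝ (Fin (m + 1)))) :=
    (measurableSet_singleton _).compl
  have hT : IsOpen (extChartAt (𝓡 m) p).target := isOpen_extChartAt_target p
  set B := (extChartAt (𝓡 m) p).target ∩ (extChartAt (𝓡 m) p).symm ⁻¹' A with hB
  have hBm : MeasurableSet B :=
    measurableSet_inter_preimage (continuousOn_extChartAt_symm p) hT.measurableSet hA
  rw [polarMeasure, Measure.map_apply_of_aemeasurable (hx.aemeasurable_polar hK) (hA.prod hJ),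
    Measure.restrict_apply' h0, chartMeasure_apply x p hA, radialMeasure_apply m hJ, ← hB,
    ← volume_polar_image (X := inChart x p) hBm (hJ.inter measurableSet_Ioi)]
  · congr 1
    ext y
    simp only [Set.mem_inter_iff, Set.mem_preimage, Set.mem_prod, Set.mem_compl_iff,
      Set.mem_singleton_iff, Set.mem_image, Prod.exists]
    constructor
    · rintro ⟨⟨hyA, hyJ⟩, hy⟩
      refine ⟨extChartAt (𝓡 m) p (footpoint x K y), _, ⟨⟨?_, ?_⟩, hyJ, hK.gauge_pos hy⟩, ?_⟩
      · exact (extChartAt (𝓡 m) p).map_source (hAp hyA)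
      · rw [Set.mem_preimage, (extChartAt (𝓡 m) p).left_inv (hAp hyA)]; exact hyA
      · simp only [inChart, Function.comp_apply]
        rw [(extChartAt (𝓡 m) p).left_inv (hAp hyA)]
        exact hx.apply_footpoint hK hy
    · rintro ⟨u, t, ⟨⟨-, hu⟩, htJ, ht⟩, rfl⟩
      rw [inChart, Function.comp_apply, hx.footpoint_smul_apply hK ht, hx.gauge_smul_apply hK ht]
      exact ⟨⟨hu, htJ⟩, smul_ne_zero (ne_of_gt ht) (hx.ne_zero hK _)⟩
  · exact fun u hu => (contDiffAt_inChart le_rfl hx.smooth p hu.1).differentiableAt (by simp)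
  · exact Set.inter_subset_right
  · rintro ⟨u, t⟩ ⟨hu, -, ht⟩ ⟨u', t'⟩ ⟨hu', -, ht'⟩ h
    have h1 := congrArg (gauge (K : Set (EuclideanSpace ℝ (Fin (m + 1))))) h
    have h2 := congrArg (footpoint x K) h
    simp only [inChart, Function.comp_apply, hx.gauge_smul_apply hK ht,
      hx.gauge_smul_apply hK ht', hx.footpoint_smul_apply hK ht,
      hx.footpoint_smul_apply hK ht'] at h1 h2
    exact Prod.ext ((extChartAt (𝓡 m) p).symm.injOn hu.1 hu'.1 h2) h1
  · exact (ENNReal.measurable_ofReal.comp_aemeasurable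
      (((hx.continuousOn_volDensity p).mono Set.inter_subset_left).aemeasurable hBm))


variable [CompactSpace M]

omit hx hK [BorelSpace M] [IsManifold (𝓡 m) ∞ M] [Nonempty M] in
/-- Measures on a compact manifold which agree on the domains of charts are equal, since finitely
many of these domains cover. -/
theorem measure_ext_of_restrict_source {μ ν : Measure M}
    (h : ∀ p, μ.restrict (extChartAt (𝓡 m) p).source = ν.restrict (extChartAt (𝓡 m) p).source) :
    μ = ν := by
  obtain ⟨t, ht⟩ := isCompact_univ.elim_nhds_subcover
    (fun p : M => (extChartAt (𝓡 m) p).source) (fun p _ => extChartAt_source_mem_nhds p)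
  refine Measure.ext_of_iUnion_eq_univ (s := fun p : t => (extChartAt (𝓡 m) p.1).source) ?_
    fun p => h p.1
  rw [Set.eq_univ_iff_forall]
  intro q
  obtain ⟨p, hp, hq⟩ := Set.mem_iUnion₂.1 (ht.2 (Set.mem_univ q))
  exact Set.mem_iUnion.2 ⟨⟨p, hp⟩, hq⟩

/-- The cone measure: `volMeasure` in terms of Lebesgue measure on `E`. -/
theorem volMeasure_apply {A : Set M} (hA : MeasurableSet A) :
    volMeasure x A = (radialMeasure m (Set.Iic 1))⁻¹ * polarMeasure x K (A ×ˢ Set.Iic 1) := by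
  -- `ν` is the measure of the cone over a set, divided by the radial mass `c` of a unit cone.
  set c := radialMeasure m (Set.Iic 1) with hc
  set ν : Measure M := c⁻¹ • ((polarMeasure x K).restrict (Set.univ ×ˢ Set.Iic 1)).map Prod.fst
    with hν
  have hνA : ∀ {A : Set M}, MeasurableSet A → ν A = c⁻¹ * polarMeasure x K (A ×ˢ Set.Iic 1) := by
    intro A hA
    rw [hν, Measure.smul_apply, smul_eq_mul, Measure.map_apply measurable_fst hA,
      Measure.restrict_apply (measurable_fst hA)]
    congr 2
    ext ⟨a, b⟩
    simp
  have hchart : ∀ p, chartMeasure x p = ν.restrict (extChartAt (𝓡 m) p).source := by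
    intro p
    have hS : MeasurableSet (extChartAt (𝓡 m) p).source :=
      (isOpen_extChartAt_source p).measurableSet
    ext A hA
    rw [Measure.restrict_apply hA, hνA (hA.inter hS), hx.polarMeasure_prod hK p (hA.inter hS)
      Set.inter_subset_right measurableSet_Iic, ← hc, mul_left_comm,
      ENNReal.inv_mul_cancel (radialMeasure_Iic_ne_zero m) (radialMeasure_Iic_ne_top m), mul_one,
      chartMeasure_inter_source x p hA]
  have hvol : volMeasure x = ν := by
    have h1 : volMeasure x = ⨆ p : M, ν.restrict (extChartAt (𝓡 m) p).source := by
      simp_rw [← hchart]; rfl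
    -- The chart measures agree on overlaps, being restrictions of `ν`, so their supremum is `ν`.
    refine measure_ext_of_restrict_source (m := m) fun p => le_antisymm ?_ ?_
    · refine Measure.restrict_mono_measure ?_ _
      rw [h1]
      exact iSup_le fun q => Measure.restrict_le_self
    · have h2 : ν.restrict (extChartAt (𝓡 m) p).source ≤ volMeasure x := by
        rw [h1]; exact le_iSup (fun p : M => ν.restrict (extChartAt (𝓡 m) p).source) p
      have h3 := Measure.restrict_mono_measure h2 (extChartAt (𝓡 m) p).source
      rwa [Measure.restrict_restrict_of_subset subset_rfl] at h3
  rw [hvol, hνA hA]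

theorem isFiniteMeasure_volMeasure : IsFiniteMeasure (volMeasure x) := by
  refine ⟨?_⟩
  have h0 : MeasurableSet ({0}ᶜ : Set (EuclideanSpace ℝ (Fin (m + 1)))) :=
    (measurableSet_singleton _).compl
  rw [hx.volMeasure_apply hK MeasurableSet.univ]
  refine ENNReal.mul_lt_top (ENNReal.inv_lt_top.2
    (pos_iff_ne_zero.2 (radialMeasure_Iic_ne_zero m))) ?_
  rw [polarMeasure, Measure.map_apply_of_aemeasurable (hx.aemeasurable_polar hK)
    (MeasurableSet.univ.prod measurableSet_Iic)]
  refine (Measure.restrict_apply_le _ _).trans_lt ((measure_mono ?_).trans_lt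
    K.isCompact.measure_lt_top)
  rintro y ⟨-, hy⟩
  have := (gauge_le_one_iff_mem_closure K.convex hK.nhds_zero).1 hy
  rwa [K.isClosed.closure_eq] at this

/-- Lebesgue measure in polar coordinates is a product measure. Its values on rectangles are
determined in charts by `polarMeasure_prod`, up to the normalization fixed in `volMeasure_apply`. -/
theorem polarMeasure_eq : polarMeasure x K = (volMeasure x).prod (radialMeasure m) := by
  have := hx.isFiniteMeasure_volMeasure hK
  refine (Measure.prod_eq fun A J hA hJ => ?_).symm
  set α : Measure M := ((polarMeasure x K).restrict (Set.univ ×ˢ J)).map Prod.fst with hα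
  have hαA : ∀ {A : Set M}, MeasurableSet A → α A = polarMeasure x K (A ×ˢ J) := by
    intro A hA
    rw [hα, Measure.map_apply measurable_fst hA, Measure.restrict_apply (measurable_fst hA)]
    congr 1
    ext ⟨a, b⟩
    simp
  have h : α = radialMeasure m J • volMeasure x := by
    refine measure_ext_of_restrict_source (m := m) fun p => ?_
    have hS : MeasurableSet (extChartAt (𝓡 m) p).source :=
      (isOpen_extChartAt_source p).measurableSet
    ext A hA
    have hAS := hA.inter hS
    rw [Measure.restrict_apply hA, Measure.restrict_apply hA, hαA hAS, Measure.smul_apply,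
      hx.volMeasure_apply hK hAS, hx.polarMeasure_prod hK p hAS Set.inter_subset_right hJ,
      hx.polarMeasure_prod hK p hAS Set.inter_subset_right measurableSet_Iic, smul_eq_mul,
      mul_left_comm _ (chartMeasure x p _),
      ENNReal.inv_mul_cancel (radialMeasure_Iic_ne_zero m) (radialMeasure_Iic_ne_top m), mul_one,
      mul_comm]
  rw [← hαA hA, h, Measure.smul_apply, smul_eq_mul, mul_comm]

/-- Integration in polar coordinates. -/
theorem integral_polar {h : EuclideanSpace ℝ (Fin (m + 1)) → ℝ} {a : M → ℝ} {k : ℝ → ℝ}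
    (ha : Continuous a) (hk : Continuous k) (hak : ∀ p, ∀ t > 0, h (t • x p) = a p * k t) :
    ∫ y, h y = (∫ p, a p ∂volMeasure x) * ∫ t in Set.Ioi 0, t ^ m * k t := by
  have := hx.isFiniteMeasure_volMeasure hK
  have h0 : MeasurableSet ({0}ᶜ : Set (EuclideanSpace ℝ (Fin (m + 1)))) :=
    (measurableSet_singleton _).compl
  have e1 : ∫ y, h y = ∫ y in {0}ᶜ, h y := by
    rw [← setIntegral_univ]
    exact setIntegral_congr_set (ae_eq_univ.2 (by simp)).symm
  have e2 : ∫ y in {0}ᶜ, h y = ∫ y in {0}ᶜ, (fun z : M × ℝ => a z.1 * k z.2)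
      (footpoint x K y, gauge (K : Set (EuclideanSpace ℝ (Fin (m + 1)))) y) := by
    refine setIntegral_congr_fun h0 fun y hy => ?_
    conv_lhs => rw [← hx.apply_footpoint hK hy]
    exact hak _ _ (hK.gauge_pos hy)
  have e3 : ∫ t, k t ∂radialMeasure m = ∫ t in Set.Ioi 0, t ^ m * k t := by
    rw [radialMeasure]
    have := integral_withDensity_eq_integral_smul (μ := volume.restrict (Set.Ioi (0 : ℝ)))
      (f := fun t : ℝ => (t ^ m).toNNReal) (measurable_id.pow_const m).real_toNNReal k
    refine this.trans (setIntegral_congr_fun measurableSet_Ioi fun t ht => ?_)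
    simp only [NNReal.smul_def, smul_eq_mul]
    rw [Real.coe_toNNReal _ (pow_nonneg (le_of_lt ht) m)]
  have e4 := integral_map (hx.aemeasurable_polar hK) (f := fun z : M × ℝ => a z.1 * k z.2)
    ((ha.measurable.comp measurable_fst).mul
      (hk.measurable.comp measurable_snd)).aestronglyMeasurable
  rw [e1, e2, ← e4, ← polarMeasure, hx.polarMeasure_eq hK, integral_prod_mul, e3]

end Parametrizes
end PolarMeasure

/-! ### The Bochner formula -/

/-- Integration by parts on the half-line against `t^m`. -/
theorem integral_pow_mul_bump (m : ℕ) {χ : ℝ → ℝ} (hχ : ContDiff ℝ 1 χ) (hc : HasCompactSupport χ)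
    (h0 : tsupport χ ⊆ Set.Ioi 0) :
    ∫ t in Set.Ioi 0, t ^ m * -(4 * χ t + t * deriv χ t) =
      ((m : ℝ) - 3) * ∫ t in Set.Ioi 0, t ^ m * χ t := by
  have hz : ∀ t ∉ Set.Ioi (0 : ℝ), χ t = 0 := fun t ht =>
    image_eq_zero_of_notMem_tsupport fun h => ht (h0 h)
  have hz' : ∀ t ∉ Set.Ioi (0 : ℝ), deriv χ t = 0 := fun t ht =>
    image_eq_zero_of_notMem_tsupport fun h => ht (h0 (tsupport_deriv_subset h))
  rw [setIntegral_eq_integral_of_forall_compl_eq_zero fun t ht => by simp [hz t ht, hz' t ht],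
    setIntegral_eq_integral_of_forall_compl_eq_zero fun t ht => by simp [hz t ht]]
  have hd' : Continuous (deriv χ) := hχ.continuous_deriv (by norm_num)
  have i1 : Integrable fun t => t ^ m * χ t :=
    ((continuous_id.pow m).mul hχ.continuous).integrable_of_hasCompactSupport hc.mul_left
  have i2 : Integrable fun t => t ^ (m + 1) * deriv χ t :=
    ((continuous_id.pow (m + 1)).mul hd').integrable_of_hasCompactSupport hc.deriv.mul_left
  have i3 : Integrable fun t => t ^ (m + 1) * χ t :=
    ((continuous_id.pow (m + 1)).mul hχ.continuous).integrable_of_hasCompactSupport hc.mul_left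
  have hG : ∫ t, (((m : ℝ) + 1) * (t ^ m * χ t) + t ^ (m + 1) * deriv χ t) = 0 := by
    refine integral_eq_zero_of_hasDerivAt_of_integrable (f := fun t => t ^ (m + 1) * χ t)
      (fun t => ?_) ((i1.const_mul _).add i2) i3
    have h1 := hasDerivAt_pow (m + 1) t
    have h2 := (hχ.differentiable (by norm_num) t).hasDerivAt
    refine (h1.mul h2).congr_deriv ?_
    push_cast
    ring
  rw [integral_add (i1.const_mul _) i2, integral_const_mul] at hG
  have e : (fun t => t ^ m * -(4 * χ t + t * deriv χ t)) =
      fun t => (-4) * (t ^ m * χ t) - t ^ (m + 1) * deriv χ t := by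
    funext t; ring
  rw [e, integral_sub (i1.const_mul _) i2, integral_const_mul]
  linarith

/-- A radial cutoff supported in a shell around the origin. -/
theorem gauge_cutoff {W : Type*} [NormedAddCommGroup W] [NormedSpace ℝ W]
    {K : ConvexBody W} (hK : SmoothPosCurved K)
    (hN : ∀ y ≠ 0, ContDiffAt ℝ ∞ (gauge (K : Set W)) y) {k : ℝ → ℝ} (hk : ContDiff ℝ 1 k)
    {r R : ℝ} (hr : 0 < r) (hR : 0 < R) (hks : ∀ t, k t ≠ 0 → r < t ∧ t < R) :
    ContDiff ℝ 1 (fun y => k (gauge (K : Set W) y)) ∧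
    HasCompactSupport (fun y => k (gauge (K : Set W) y)) ∧
    tsupport (fun y => k (gauge (K : Set W) y)) ⊆ {0}ᶜ := by
  have hcont : Continuous (gauge (K : Set W)) := continuous_gauge K.convex hK.nhds_zero
  have hnear : (fun y => k (gauge (K : Set W) y)) =ᶠ[𝓝 0] 0 := by
    have h1 : ∀ᶠ y in 𝓝 (0 : W), gauge (K : Set W) y < r :=
      hcont.continuousAt.eventually_lt_const (by rwa [gauge_zero])
    filter_upwards [h1] with y hy
    by_contra h
    exact absurd (hks _ h).1 (not_lt.2 hy.le)
  refine ⟨?_, ?_, ?_⟩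
  · rw [contDiff_iff_contDiffAt]
    intro y
    by_cases hy : y = 0
    · rw [hy]
      exact (contDiffAt_const (c := (0 : ℝ))).congr_of_eventuallyEq hnear
    · exact hk.contDiffAt.comp y ((hN y hy).of_le ENat.LEInfty.out)
  · refine HasCompactSupport.intro (K.isCompact.smul R) fun y hy => ?_
    by_contra h
    apply hy
    have h1 : gauge (K : Set W) (R⁻¹ • y) ≤ 1 := by
      rw [gauge_smul_of_nonneg (inv_nonneg.2 hR.le), smul_eq_mul, inv_mul_le_iff₀ hR, mul_one]
      exact (hks _ h).2.le
    rw [gauge_le_one_iff_mem_closure K.convex hK.nhds_zero, K.isClosed.closure_eq] at h1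
    exact ⟨_, h1, smul_inv_smul₀ hR.ne' y⟩
  · intro y hy h0
    rw [Set.mem_singleton_iff] at h0
    rw [h0] at hy
    exact notMem_tsupport_iff_eventuallyEq.2 hnear hy

namespace Parametrizes

variable {m : ℕ} {K : ConvexBody (EuclideanSpace ℝ (Fin (m + 1)))}
  {M : Type*} [TopologicalSpace M] [ChartedSpace (EuclideanSpace ℝ (Fin m)) M]
  [CompactSpace M] [IsManifold (𝓡 m) ∞ M] [MeasurableSpace M] [BorelSpace M]
  {x : M → EuclideanSpace ℝ (Fin (m + 1))}
  (hx : Parametrizes x K) (hK : SmoothPosCurved K)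
include hx hK

omit [CompactSpace M] [IsManifold (𝓡 m) ∞ M] [MeasurableSpace M] [BorelSpace M] in
theorem nonempty : Nonempty M := by
  obtain ⟨y, hy⟩ := exists_ne (0 : EuclideanSpace ℝ (Fin (m + 1)))
  have hg := hK.gauge_pos hy
  have h1 : (gauge (K : Set (EuclideanSpace ℝ (Fin (m + 1)))) y)⁻¹ • y ∈ Set.range x := by
    rw [hx.range_eq, ← hK.gauge_eq_one_iff, gauge_smul_of_nonneg (inv_nonneg.2 hg.le),
      smul_eq_mul, inv_mul_cancel₀ hg.ne']
  exact ⟨h1.choose⟩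

/-- The flat form of the Bochner formula. The two integrands are the restrictions to the
hypersurface of functions of degree `-4` and `-3`, and the weight `k(N)` of the integration by parts
turns the difference between these degrees and the dimension into the factor `m - 3`. -/
theorem integral_trace_sq_sub [Nonempty M] {F : EuclideanSpace ℝ (Fin (m + 1)) → ℝ}
    {ζ : EuclideanSpace ℝ (Fin (m + 1)) → EuclideanSpace ℝ (Fin (m + 1))}
    (h : IsGaugeGradient (gauge (K : Set (EuclideanSpace ℝ (Fin (m + 1))))) F ζ)
    (hζ : IsHomogeneous (-1) ζ)
    (ha : Continuous fun p => LinearMap.trace ℝ _ (fderiv ℝ ζ (x p)).toLinearMap ^ 2 -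
        LinearMap.trace ℝ _ ((fderiv ℝ ζ (x p)).comp (fderiv ℝ ζ (x p))).toLinearMap)
    (hg : Continuous fun p => fderiv ℝ (fderiv ℝ (gauge (K : Set (EuclideanSpace ℝ (Fin (m + 1))))))
      (x p) (ζ (x p)) (ζ (x p))) :
    ∫ p, (LinearMap.trace ℝ _ (fderiv ℝ ζ (x p)).toLinearMap ^ 2 -
        LinearMap.trace ℝ _ ((fderiv ℝ ζ (x p)).comp (fderiv ℝ ζ (x p))).toLinearMap)
        ∂volMeasure x = ((m : ℝ) - 3) *
      ∫ p, fderiv ℝ (fderiv ℝ (gauge (K : Set (EuclideanSpace ℝ (Fin (m + 1)))))) (x p)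
        (ζ (x p)) (ζ (x p)) ∂volMeasure x := by
  have hhom := SmoothPosCurved.gauge_isHomogeneous K
  set N := gauge (K : Set (EuclideanSpace ℝ (Fin (m + 1)))) with hN
  -- Centred at `2` with outer radius `1`, the bump lives in `(1, 3)`, away from the origin where
  -- the gauge and `ζ` are not smooth.
  let χ : ContDiffBump (2 : ℝ) := ⟨1 / 2, 1, by norm_num, by norm_num⟩
  have hχs : ∀ t, χ t ≠ 0 → 1 < t ∧ t < 3 := by
    intro t ht
    have : t ∈ Function.support χ := ht
    rw [χ.support_eq, Real.ball_eq_Ioo] at this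
    have h1 := this.1
    have h2 := this.2
    simp only [χ] at h1 h2
    exact ⟨by linarith, by linarith⟩
  have hχ1 : ContDiff ℝ 1 χ := χ.contDiff
  have hχt : tsupport χ ⊆ Set.Ioi 0 := by
    rw [χ.tsupport_eq, Real.closedBall_eq_Icc]
    intro t ht
    have h1 := ht.1
    simp only [χ] at h1
    exact lt_of_lt_of_le (by norm_num) h1
  -- The factor `t ^ 4` cancels the degree `-4` of the trace integrand along rays.
  set k : ℝ → ℝ := fun t => t ^ 4 * χ t with hk
  have hk1 : ContDiff ℝ 1 k := (contDiff_id.pow 4).mul hχ1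
  have hk' : ∀ t, HasDerivAt k (4 * t ^ 3 * χ t + t ^ 4 * deriv χ t) t := fun t => by
    have h1 := hasDerivAt_pow 4 t
    exact (h1.mul (hχ1.differentiable (by norm_num) t).hasDerivAt).congr_deriv (by norm_num)
  obtain ⟨hw1, hw2, hw3⟩ := gauge_cutoff hK (k := k) (fun y hy => hx.contDiffAt_gauge hK hy) hk1
    (r := 1) (R := 3) one_pos (by norm_num) (fun t ht => hχs t (right_ne_zero_of_mul ht))
  have hparts := integral_mul_trace_sq_sub_of_tsupport_subset (μ := volume)
    isOpen_compl_singleton hw1 hw2 hw3 (fun y hy => h.contDiffAt_grad y hy)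
  rw [← hN] at hparts
  have hwd : ∀ y ≠ 0, ∀ v, fderiv ℝ (fun y => k (N y)) y v =
      (4 * N y ^ 3 * χ (N y) + N y ^ 4 * deriv χ (N y)) * fderiv ℝ N y v := by
    intro y hy v
    have h1 : HasFDerivAt N (fderiv ℝ N y) y :=
      ((h.contDiffAt_gauge y hy).differentiableAt (by simp)).hasFDerivAt
    have h2 := (hk' (N y)).comp_hasFDerivAt y h1
    have h3 : fderiv ℝ (fun y => k (N y)) y = _ := h2.fderiv
    rw [h3]; simp
  rw [hx.integral_polar hK (a := fun p => LinearMap.trace ℝ _ (fderiv ℝ ζ (x p)).toLinearMap ^ 2 -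
        LinearMap.trace ℝ _ ((fderiv ℝ ζ (x p)).comp (fderiv ℝ ζ (x p))).toLinearMap)
      (k := χ) ha χ.continuous,
    hx.integral_polar hK (a := fun p => fderiv ℝ (fderiv ℝ N) (x p) (ζ (x p)) (ζ (x p)))
      (k := fun t => -(4 * χ t + t * deriv χ t)) hg,
    integral_pow_mul_bump m hχ1 χ.hasCompactSupport hχt] at hparts
  · have hI : ∫ t in Set.Ioi 0, t ^ m * χ t ≠ 0 := by
      have hz : ∀ t ∉ Set.Ioi (0 : ℝ), χ t = 0 := fun t ht =>
        image_eq_zero_of_notMem_tsupport fun h => ht (hχt h)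
      rw [setIntegral_eq_integral_of_forall_compl_eq_zero fun t ht => by rw [hz t ht, mul_zero]]
      refine ne_of_gt (Continuous.integral_pos_of_hasCompactSupport_nonneg_nonzero (x := 2)
        ((continuous_id.pow m).mul χ.continuous) χ.hasCompactSupport.mul_left (fun t => ?_) ?_)
      · by_cases ht : t ∈ Set.Ioi (0 : ℝ)
        · exact mul_nonneg (pow_nonneg (le_of_lt ht) m) χ.nonneg
        · simp [hz t ht]
      · have h1 : χ 2 = 1 := χ.one_of_mem_closedBall (Metric.mem_closedBall_self χ.rIn_pos.le)
        simp [h1]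
    have : ∀ a b c I : ℝ, I ≠ 0 → a * I = b * (c * I) → a = c * b := fun a b c I hI h => by
      have : (a - c * b) * I = 0 := by linarith
      have := (mul_eq_zero.1 this).resolve_right hI
      linarith
    exact this _ _ _ _ hI hparts
  · have := hχ1.continuous_deriv (by norm_num)
    have := χ.continuous
    fun_prop
  · intro p t ht
    have hy : t • x p ≠ 0 := smul_ne_zero ht.ne' (hx.ne_zero hK p)
    have hNt : N (t • x p) = t := hx.gauge_smul_apply hK ht p
    rw [hwd _ hy, hwd _ hy, h.tangent _ hy, h.fderiv_gauge_fderiv_grad hy, hNt,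
      hhom.fderiv.fderiv t ht, hζ t ht]
    simp
    field_simp
    ring
  · intro p t ht
    have hNt : N (t • x p) = t := hx.gauge_smul_apply hK ht p
    rw [hNt, hζ.fderiv t ht]
    have e1 : ∀ (c : ℝ) (A : EuclideanSpace ℝ (Fin (m + 1)) →L[ℝ] EuclideanSpace ℝ (Fin (m + 1))),
        (c • A).toLinearMap = c • A.toLinearMap := fun c A => rfl
    have e2 : ∀ (c : ℝ) (A : EuclideanSpace ℝ (Fin (m + 1)) →L[ℝ] EuclideanSpace ℝ (Fin (m + 1))),
        ((c • A).comp (c • A)).toLinearMap = c ^ 2 • (A.comp A).toLinearMap := fun c A => by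
      ext y; simp [sq, mul_assoc]
    rw [e2, e1, map_smul, map_smul]
    simp only [hk, smul_eq_mul]
    have : t ≠ 0 := ht.ne'
    norm_num
    field_simp

end Parametrizes

end CentroAffine

open CentroAffine

theorem theorem5p2 (m : ℕ) (K : ConvexBody (EuclideanSpace ℝ (Fin (m + 1))))
    (hK : CentroAffine.SmoothPosCurved K)
    {M : Type*} [TopologicalSpace M] [T2Space M] [CompactSpace M]
    [ChartedSpace (EuclideanSpace ℝ (Fin m)) M] [IsManifold (𝓡 m) ∞ M]
    [MeasurableSpace M] [BorelSpace M]
    (x : M → EuclideanSpace ℝ (Fin (m + 1))) (hx : CentroAffine.Parametrizes x K)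
    (f : M → ℝ) (hf : ContMDiff (𝓡 m) 𝓘(ℝ, ℝ) 2 f) :
    MeasureTheory.Integrable (fun p => CentroAffine.lap x f p ^ 2) (CentroAffine.volMeasure x) ∧
    MeasureTheory.Integrable (CentroAffine.hessStarNormSq x f) (CentroAffine.volMeasure x) ∧
    MeasureTheory.Integrable (CentroAffine.gradSq x f) (CentroAffine.volMeasure x) ∧
    (∫ p, CentroAffine.lap x f p ^ 2 ∂(CentroAffine.volMeasure x)) -
        ∫ p, CentroAffine.hessStarNormSq x f p ∂(CentroAffine.volMeasure x) =
      (((m + 1 : ℕ) : ℝ) - 2) *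
        ∫ p, CentroAffine.gradSq x f p ∂(CentroAffine.volMeasure x) := by
  have := hx.nonempty hK
  have := hx.isFiniteMeasure_volMeasure hK
  set N := gauge (K : Set (EuclideanSpace ℝ (Fin (m + 1)))) with hN
  set F := fun y => f (footpoint x K y) with hF
  set ζ := gaugeGradient N F with hζ
  have hgg : IsGaugeGradient N F ζ := hx.isGaugeGradient hK hf
  have hhom : IsHomogeneous (-1) ζ := gaugeGradient_isHomogeneous
    (SmoothPosCurved.gauge_isHomogeneous K) (Parametrizes.comp_footpoint_isHomogeneous x K f)
  have hxc : Continuous x := hx.smooth.continuous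
  have hx0 : ∀ p, x p ≠ 0 := hx.ne_zero hK
  have comp_x : ∀ {β : Type} [TopologicalSpace β] {g : EuclideanSpace ℝ (Fin (m + 1)) → β},
      (∀ y ≠ 0, ContinuousAt g y) → Continuous fun p => g (x p) := fun hg =>
    continuous_iff_continuousAt.2 fun p =>
      ContinuousAt.comp (hg _ (hx0 p)) hxc.continuousAt
  have hζc : Continuous fun p => ζ (x p) :=
    comp_x fun y hy => (hgg.contDiffAt_grad y hy).continuousAt
  have hDζ : Continuous fun p => fderiv ℝ ζ (x p) :=
    comp_x fun y hy => ((hgg.contDiffAt_grad y hy).fderiv_right (m := 0) (by norm_num)).continuousAt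
  have hD2N : Continuous fun p => fderiv ℝ (fderiv ℝ N) (x p) :=
    comp_x fun y hy => (((hgg.contDiffAt_gauge y hy).fderiv_right (m := 1)
      (by norm_num; exact ENat.LEInfty.out)).fderiv_right (m := 0) (by norm_num)).continuousAt
  have htr : Continuous fun A : EuclideanSpace ℝ (Fin (m + 1)) →L[ℝ] EuclideanSpace ℝ (Fin (m + 1)) =>
      LinearMap.trace ℝ (EuclideanSpace ℝ (Fin (m + 1))) A.toLinearMap :=
    LinearMap.continuous_of_finiteDimensional
      (LinearMap.trace ℝ (EuclideanSpace ℝ (Fin (m + 1))) ∘ₗ ContinuousLinearMap.coeLM ℝ)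
  have hlap : ∀ p, lap x f p = LinearMap.trace ℝ _ (fderiv ℝ ζ (x p)).toLinearMap :=
    hx.lap_eq hK hf
  have hgrad : ∀ p, gradSq x f p = fderiv ℝ (fderiv ℝ N) (x p) (ζ (x p)) (ζ (x p)) :=
    hx.gradSq_eq hK hf
  have hhess : ∀ p, hessStarNormSq x f p =
      LinearMap.trace ℝ _ ((fderiv ℝ ζ (x p)).comp (fderiv ℝ ζ (x p))).toLinearMap -
        2 * gradSq x f p := hx.hessStarNormSq_eq hK hf
  have hc1 : Continuous fun p => lap x f p ^ 2 := by
    simp_rw [hlap]; exact (htr.comp hDζ).pow 2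
  have hc3 : Continuous fun p => gradSq x f p := by
    simp_rw [hgrad]; exact (hD2N.clm_apply hζc).clm_apply hζc
  have hc4 : Continuous fun p =>
      LinearMap.trace ℝ _ ((fderiv ℝ ζ (x p)).comp (fderiv ℝ ζ (x p))).toLinearMap :=
    htr.comp (hDζ.clm_comp hDζ)
  have hc5 : Continuous fun p => LinearMap.trace ℝ _ (fderiv ℝ ζ (x p)).toLinearMap ^ 2 -
      LinearMap.trace ℝ _ ((fderiv ℝ ζ (x p)).comp (fderiv ℝ ζ (x p))).toLinearMap :=
    ((htr.comp hDζ).pow 2).sub hc4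
  have hc2 : Continuous fun p => hessStarNormSq x f p := by
    simp_rw [hhess]; exact hc4.sub (continuous_const.mul hc3)
  have hint : ∀ {g : M → ℝ}, Continuous g → MeasureTheory.Integrable g (volMeasure x) :=
    fun hg => hg.integrable_of_hasCompactSupport (HasCompactSupport.of_compactSpace _)
  refine ⟨hint hc1, hint hc2, hint hc3, ?_⟩
  have hflat : ∫ p, (LinearMap.trace ℝ _ (fderiv ℝ ζ (x p)).toLinearMap ^ 2 -
      LinearMap.trace ℝ _ ((fderiv ℝ ζ (x p)).comp (fderiv ℝ ζ (x p))).toLinearMap)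
      ∂volMeasure x = ((m : ℝ) - 3) * ∫ p, gradSq x f p ∂volMeasure x := by
    simp_rw [hgrad]
    exact hx.integral_trace_sq_sub hK hgg hhom hc5 (by simpa only [hgrad] using hc3)
  rw [← MeasureTheory.integral_sub (hint hc1) (hint hc2)]
  have e : ∀ p, lap x f p ^ 2 - hessStarNormSq x f p =
      (LinearMap.trace ℝ _ (fderiv ℝ ζ (x p)).toLinearMap ^ 2 -
        LinearMap.trace ℝ _ ((fderiv ℝ ζ (x p)).comp (fderiv ℝ ζ (x p))).toLinearMap) +
      2 * gradSq x f p := fun p => by rw [hhess, hlap]; ring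
  simp_rw [e]
  rw [MeasureTheory.integral_add (hint hc5) ((hint hc3).const_mul 2), hflat,
    MeasureTheory.integral_const_mul]
  push_cast
  ring
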